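/- Let $E$ be a smooth manifold of dimension $n+m$ and $M$ a smooth manifold of dimension $n$ (both Hausdorff and second countable), and let $\Gamma$ and $\Theta$ be smooth torsion-free linear connections on $TE\to E$ and $TM\to M$. *Jets of submanifolds.* Let $\pi_{1,0}\colon J^1(E,n)\to E$ be the bundle of first jets $\theta=[L]^1_p$ of $n$-dimensional submanifolds $L\subset E$, identified with the Grassmann bundle of $n$-planes $R_\theta=T_pL\subset T_pE$. Over $J^1(E,n)$ put $T^{1,0}=\pi_{1,0}^*(TE)$, $H^{1,0}=\{(\theta,v): v\in R_\theta\}\subset T^{1,0}$, $V^{1,0}=T^{1,0}/H^{1,0}$, let $\omega^1\colon T^{1,0}\to V^{1,0}$ be the quotient map, and let $D^1$ be the section of $(H^{1,0})^*\otimes T^{1,0}$ given by the inclusion $H^{1,0}\hookrightarrow T^{1,0}$. Identify $\ker T\pi_{1,0}\simeq (H^{1,0})^*\otimes V^{1,0}$ by sending the velocity $\gamma'(0)$ of a curve $\gamma$ in a fibre of $\pi_{1,0}$ to $(\mathrm{id}\otimes\omega^1)\left(\frac{d}{dt}\big|_{t=0}D^1(\gamma(t))\right)$. The connection $\dot\Gamma$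 on $\pi_{1,0}$ is the one with vertical projection $$\upsilon_{\dot\Gamma}=(\mathrm{id}\otimes\omega^1)\circ\upsilon_{\Omega}\circ TD^1\colon TJ^1(E,n)\to\ker T\pi_{1,0},\qquad \Omega=\Xi^*\otimes\pi_{1,0}^*(\Gamma),$$ where $\Xi$ is an arbitrary smooth linear connection on $H^{1,0}$, $\Xi^*$ is its dual, and $\upsilon_\Omega$ is the vertical projection of the linear connection $\Omega$ on $(H^{1,0})^*\otimes T^{1,0}$. *Parametrized jets.* Let $\mathrm{pr}_M,\mathrm{pr}_E$ be the projections of $M\times E$, and let $J^1\mathrm{pr}_M=\mathrm{pr}_E^*(TE)\otimes\mathrm{pr}_M^*(T^*M)$ be the bundle over $M\times E$ of first jets $[s]^1_x$ of local maps $s\colon M\to E$, regarded as sections of $\mathrm{pr}_M$ and identified with the linear maps $T_xs\colon T_xM\to T_{s(x)}E$; write $\mathrm{pr}_{M\,1,0}\colon J^1\mathrm{pr}_M\to M\times E$ for its projection. Let $\dot\Gamma_{\mathrm{pr}_M}=\mathrm{pr}_E^*(\Gamma)\otimes\mathrm{pr}_M^*(\Theta^*)$, a linear connection on $\mathrm{pr}_{M\,1,0}$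 with vertical projection $\upsilon_{\dot\Gamma_{\mathrm{pr}_M}}\colon TJ^1\mathrm{pr}_M\to\ker T\mathrm{pr}_{M\,1,0}$. Let $\mathrm{Imm}\,J^1\mathrm{pr}_M$ be the open set of jets of immersions, and let $$\mathrm{pr}_E^{(1)}\colon \mathrm{Imm}\,J^1\mathrm{pr}_M\to J^1(E,n),\qquad [s]^1_x\mapsto[\mathrm{im}\,s]^1_{s(x)},$$ that is, $\mathrm{pr}_E^{(1)}$ sends a linear map $T_xM\to T_pE$ to its image. **Theorem.** The map $\mathrm{pr}_E^{(1)}$ is smooth on $\mathrm{Imm}\,J^1\mathrm{pr}_M$ and, for every choice of $\Xi$, $$T\mathrm{pr}_E^{(1)}\circ\upsilon_{\dot\Gamma_{\mathrm{pr}_M}}=\upsilon_{\dot\Gamma}\circ T\mathrm{pr}_E^{(1)}\qquad\text{on } T(\mathrm{Imm}\,J^1\mathrm{pr}_M).$$ In this sense $\dot\Gamma$ is the quotient connection of $\dot\Gamma_{\mathrm{pr}_M}$ via $\mathrm{pr}_E^{(1)}$. -/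

import Mathlib

open Set Bundle Topology Manifold
open scoped ContDiff

noncomputable section

/-- The model space `ℝ^d`. -/
abbrev Rn (d : ℕ) : Type := EuclideanSpace ℝ (Fin d)

/-! ### The space of 1-jets of `n`-dimensional submanifolds (Grassmann bundle) -/

section JetSpace

variable (n m : ℕ) (E : Type*) [TopologicalSpace E] [ChartedSpace (Rn (n + m)) E]

/-- The space `J¹(E,n)` of first jets of `n`-dimensional submanifolds of an `(n+m)`-dimensional
manifold `E`: the jet `[L]¹_p` is identified with the tangent plane `T_p L`, so that a point is a
pair `(p, W)` with `W` an `n`-dimensional subspace of `T_p E`. -/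
structure JetSub where
  pt : E
  plane : Submodule ℝ (TangentSpace 𝓘(ℝ, Rn (n + m)) pt)
  finrank_plane : Module.finrank ℝ plane = n

/-- A divided chart `(u^λ, u^i)` of `E`: a chart of the atlas followed by a linear splitting of
`ℝ^(n+m)` into `ℝ^n × ℝ^m`. -/
structure DividedChart where
  chart : OpenPartialHomeomorph E (Rn (n + m))
  mem : chart ∈ atlas (Rn (n + m)) E
  split : Rn (n + m) ≃L[ℝ] Rn n × Rn m

variable {n m E}

/-- The coordinates of a point in a divided chart. -/
def DividedChart.coord (c : DividedChart n m E) (p : E) : Rn n × Rn m := c.split (c.chart p)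

/-- The differential at `p` of a divided chart. -/
def DividedChart.diff (c : DividedChart n m E) (p : E) :
    TangentSpace 𝓘(ℝ, Rn (n + m)) p →L[ℝ] Rn n × Rn m :=
  (c.split : Rn (n + m) →L[ℝ] Rn n × Rn m) ∘L
    (mfderiv 𝓘(ℝ, Rn (n + m)) 𝓘(ℝ, Rn (n + m)) c.chart p :
      TangentSpace 𝓘(ℝ, Rn (n + m)) p →L[ℝ] Rn (n + m))

theorem exists_splitting (W : Submodule ℝ (Rn (n + m))) (hW : Module.finrank ℝ W = n) :
    ∃ L : Rn (n + m) ≃L[ℝ] Rn n × Rn m,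
      W.map (L : Rn (n + m) →ₗ[ℝ] Rn n × Rn m) = (0 : Rn n →ₗ[ℝ] Rn m).graph := by
  obtain ⟨K, hK⟩ := W.exists_isCompl
  have hsum := Submodule.finrank_add_eq_of_isCompl hK
  have hKm : Module.finrank ℝ K = m := by
    rw [hW] at hsum; simp at hsum; exact hsum
  have e1 : W ≃ₗ[ℝ] Rn n := LinearEquiv.ofFinrankEq _ _ (by simp [hW])
  have e2 : K ≃ₗ[ℝ] Rn m := LinearEquiv.ofFinrankEq _ _ (by simp [hKm])
  let L := ((Submodule.prodEquivOfIsCompl W K hK).symm.trans (e1.prodCongr e2))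
  have hL : ∀ x : W, L x = (e1 x, 0) := by
    intro x
    simp [L]
  refine ⟨L.toContinuousLinearEquiv, ?_⟩
  ext ⟨a, b⟩
  simp only [Submodule.mem_map, LinearMap.mem_graph_iff, LinearMap.zero_apply]
  constructor
  · rintro ⟨x, hx, hxe⟩
    have h2 : L x = (a, b) := hxe
    have := hL ⟨x, hx⟩
    simp only at this
    rw [h2] at this
    exact (Prod.ext_iff.1 this).2
  · rintro rfl
    refine ⟨(e1.symm a : W), (e1.symm a).2, ?_⟩
    have := hL (e1.symm a)
    simpa using! this

theorem exists_plane (p : E) : ∃ W : Submodule ℝ (TangentSpace 𝓘(ℝ, Rn (n + m)) p),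
    Module.finrank ℝ W = n := by
  have hdim : Module.finrank ℝ (Rn n × Rn m) = Module.finrank ℝ (Rn (n + m)) := by
    rw [Module.finrank_prod]; simp
  let e : (Rn n × Rn m) ≃ₗ[ℝ] Rn (n + m) := LinearEquiv.ofFinrankEq _ _ hdim
  have hf : Function.Injective (e.toLinearMap ∘ₗ LinearMap.inl ℝ (Rn n) (Rn m)) :=
    e.injective.comp LinearMap.inl_injective
  exact ⟨LinearMap.range _, (LinearMap.finrank_range_of_inj hf).trans (finrank_euclideanSpace_fin (𝕜 := ℝ))⟩

open Classical in
/-- The point `(p, W)` of `J¹(E,n)` given by a subspace `W` of `T_p E`; a subspace of the wrong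
dimension is replaced by an arbitrary one. -/
def JetSub.ofSubmodule (p : E) (W : Submodule ℝ (TangentSpace 𝓘(ℝ, Rn (n + m)) p)) :
    JetSub n m E :=
  if h : Module.finrank ℝ W = n then ⟨p, W, h⟩
  else ⟨p, (exists_plane p).choose, (exists_plane p).choose_spec⟩

/-- The slope of a subspace of `ℝ^n × ℝ^m` that is the graph of a linear map. -/
def graphSlope (S : Submodule ℝ (Rn n × Rn m)) : Rn n →L[ℝ] Rn m :=
  open Classical in
  if h : ∃ A : Rn n →L[ℝ] Rn m, S = (A : Rn n →ₗ[ℝ] Rn m).graph then h.choose else 0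

theorem graph_inj {A B : Rn n →L[ℝ] Rn m}
    (h : (A : Rn n →ₗ[ℝ] Rn m).graph = (B : Rn n →ₗ[ℝ] Rn m).graph) : A = B := by
  ext1 x
  have : (x, A x) ∈ (B : Rn n →ₗ[ℝ] Rn m).graph := by rw [← h]; simp [LinearMap.mem_graph_iff]
  simpa [LinearMap.mem_graph_iff] using this

theorem graphSlope_graph (A : Rn n →L[ℝ] Rn m) : graphSlope (A : Rn n →ₗ[ℝ] Rn m).graph = A := by
  have h : ∃ B : Rn n →L[ℝ] Rn m,
    (A : Rn n →ₗ[ℝ] Rn m).graph = (B : Rn n →ₗ[ℝ] Rn m).graph := ⟨A, rfl⟩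
  rw [graphSlope, dif_pos h]
  exact graph_inj h.choose_spec.symm

/-- The domain of the chart of `J¹(E,n)` induced by a divided chart: the planes that project
isomorphically onto `ℝ^n`, that is, the tangent planes to the submanifolds `u^i = f^i(u^λ)`. -/
def DividedChart.domain (c : DividedChart n m E) : Set (JetSub n m E) :=
  {θ | θ.pt ∈ c.chart.source ∧ ∃ A : Rn n →L[ℝ] Rn m,
    θ.plane.map (c.diff θ.pt : TangentSpace 𝓘(ℝ, Rn (n + m)) θ.pt →ₗ[ℝ] Rn n × Rn m) =
      (A : Rn n →ₗ[ℝ] Rn m).graph}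

/-- The coordinates `(u^i_λ)` of a plane. -/
def DividedChart.jetSlope (c : DividedChart n m E) (θ : JetSub n m E) : Rn n →L[ℝ] Rn m :=
  graphSlope (θ.plane.map
    (c.diff θ.pt : TangentSpace 𝓘(ℝ, Rn (n + m)) θ.pt →ₗ[ℝ] Rn n × Rn m))

theorem DividedChart.map_diff_plane (c : DividedChart n m E) {θ : JetSub n m E}
    (h : θ ∈ c.domain) :
    θ.plane.map (c.diff θ.pt : TangentSpace 𝓘(ℝ, Rn (n + m)) θ.pt →ₗ[ℝ] Rn n × Rn m) =
      (c.jetSlope θ : Rn n →ₗ[ℝ] Rn m).graph := by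
  obtain ⟨-, A, hA⟩ := h
  rw [jetSlope, hA, graphSlope_graph]

variable [IsManifold 𝓘(ℝ, Rn (n + m)) ∞ E]

theorem DividedChart.diff_bijective (c : DividedChart n m E) {p : E} (hp : p ∈ c.chart.source) :
    Function.Bijective (c.diff p) := by
  have h := mdifferentiable_of_mem_atlas (I := 𝓘(ℝ, Rn (n + m))) c.mem
  have := (h.mfderiv hp).bijective
  exact c.split.bijective.comp this

theorem finrank_graph (A : Rn n →L[ℝ] Rn m) :
    Module.finrank ℝ (A : Rn n →ₗ[ℝ] Rn m).graph = n := by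
  rw [LinearMap.graph_eq_range_prod, LinearMap.finrank_range_of_inj]
  · simp
  · intro x y h; exact (Prod.ext_iff.1 h).1

theorem DividedChart.finrank_comap (c : DividedChart n m E) {p : E} (hp : p ∈ c.chart.source)
    (A : Rn n →L[ℝ] Rn m) :
    Module.finrank ℝ ((A : Rn n →ₗ[ℝ] Rn m).graph.comap
      (c.diff p : TangentSpace 𝓘(ℝ, Rn (n + m)) p →ₗ[ℝ] Rn n × Rn m)) = n := by
  have hb := c.diff_bijective hp
  let e := LinearEquiv.ofBijective (c.diff p : TangentSpace 𝓘(ℝ, Rn (n + m)) p →ₗ[ℝ] Rn n × Rn m) hb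
  have := LinearEquiv.finrank_eq (e.submoduleMap ((A : Rn n →ₗ[ℝ] Rn m).graph.comap
      (c.diff p : TangentSpace 𝓘(ℝ, Rn (n + m)) p →ₗ[ℝ] Rn n × Rn m)))
  rw [this]
  have h2 : Submodule.map (e : TangentSpace 𝓘(ℝ, Rn (n + m)) p →ₗ[ℝ] Rn n × Rn m)
    ((A : Rn n →ₗ[ℝ] Rn m).graph.comap
      (c.diff p : TangentSpace 𝓘(ℝ, Rn (n + m)) p →ₗ[ℝ] Rn n × Rn m)) = (A : Rn n →ₗ[ℝ] Rn m).graph :=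
    Submodule.map_comap_eq_of_surjective hb.2 _
  have h3 := finrank_graph A
  rw [← h2] at h3
  exact h3

/-- The chart `(u^λ, u^i, u^i_λ)` of `J¹(E,n)` induced by a divided chart `(u^λ, u^i)`. -/
def DividedChart.jetChart (c : DividedChart n m E) :
    PartialEquiv (JetSub n m E) ((Rn n × Rn m) × (Rn n →L[ℝ] Rn m)) where
  toFun θ := (c.coord θ.pt, c.jetSlope θ)
  invFun z := JetSub.ofSubmodule (c.chart.symm (c.split.symm z.1))
    ((z.2 : Rn n →ₗ[ℝ] Rn m).graph.comap (c.diff (c.chart.symm (c.split.symm z.1)) :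
      TangentSpace 𝓘(ℝ, Rn (n + m)) (c.chart.symm (c.split.symm z.1)) →ₗ[ℝ] Rn n × Rn m))
  source := c.domain
  target := {z | c.split.symm z.1 ∈ c.chart.target}
  map_source' := by
    rintro θ ⟨h, -⟩
    simpa [coord] using c.chart.map_source h
  map_target' := by
    rintro ⟨q, A⟩ h
    have hp := c.chart.map_target h
    rw [JetSub.ofSubmodule, dif_pos (c.finrank_comap hp A)]
    exact ⟨hp, A, Submodule.map_comap_eq_of_surjective (c.diff_bijective hp).2 _⟩
  left_inv' := by
    rintro ⟨p, W, hW⟩ h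
    have hs := c.map_diff_plane h
    obtain ⟨hp, -⟩ := h
    have e : c.chart.symm (c.split.symm (c.coord p)) = p := by
      simpa [coord] using c.chart.left_inv hp
    simp only at hs ⊢
    rw [← hs, e, Submodule.comap_map_eq_of_injective (c.diff_bijective hp).1,
      JetSub.ofSubmodule, dif_pos hW]
  right_inv' := by
    rintro ⟨q, A⟩ h
    have hp := c.chart.map_target h
    simp only
    rw [JetSub.ofSubmodule, dif_pos (c.finrank_comap hp A)]
    ext1
    · simpa [coord] using congrArg c.split (c.chart.right_inv h)
    · exact (congrArg graphSlope (Submodule.map_comap_eq_of_surjective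
        (c.diff_bijective hp).2 _)).trans (graphSlope_graph A)

theorem JetSub.pt_ofSubmodule (p : E)
    (W : Submodule ℝ (TangentSpace 𝓘(ℝ, Rn (n + m)) p)) :
    (JetSub.ofSubmodule (n := n) (m := m) p W).pt = p := by
  unfold JetSub.ofSubmodule; split_ifs <;> rfl

/-- The change of coordinates between two divided charts of `E`. -/
def transitionMap (c c' : DividedChart n m E) (q : Rn n × Rn m) : Rn n × Rn m :=
  c'.coord (c.chart.symm (c.split.symm q))

/-- The set where the change of coordinates between two divided charts of `E` is defined. -/
def transitionSource (c c' : DividedChart n m E) : Set (Rn n × Rn m) :=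
  c.split.symm ⁻¹' (c.chart.symm.trans c'.chart).source

/-- The first block `∂u'^ξ/∂u^λ + u^i_λ ∂u'^ξ/∂u^i` of the total derivative of the change of
coordinates. -/
def transitionFst (c c' : DividedChart n m E) (z : (Rn n × Rn m) × (Rn n →L[ℝ] Rn m)) :
    Rn n →L[ℝ] Rn n :=
  (ContinuousLinearMap.fst ℝ (Rn n) (Rn m)).comp
    ((fderiv ℝ (transitionMap c c') z.1).comp ((ContinuousLinearMap.id ℝ (Rn n)).prod z.2))

/-- The second block of the total derivative of the change of coordinates. -/
def transitionSnd (c c' : DividedChart n m E) (z : (Rn n × Rn m) × (Rn n →L[ℝ] Rn m)) :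
    Rn n →L[ℝ] Rn m :=
  (ContinuousLinearMap.snd ℝ (Rn n) (Rn m)).comp
    ((fderiv ℝ (transitionMap c c') z.1).comp ((ContinuousLinearMap.id ℝ (Rn n)).prod z.2))

theorem isOpen_transitionSource (c c' : DividedChart n m E) : IsOpen (transitionSource c c') :=
  (c.chart.symm.trans c'.chart).open_source.preimage c.split.symm.continuous

theorem contDiffOn_transitionMap (c c' : DividedChart n m E) :
    ContDiffOn ℝ ∞ (transitionMap c c') (transitionSource c c') := by
  have h : ContDiffOn ℝ ∞ (c.chart.symm.trans c'.chart) (c.chart.symm.trans c'.chart).source := by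
    have h1 := (contDiffGroupoid ∞ 𝓘(ℝ, Rn (n + m))).compatible c.mem c'.mem
    have h2 := (contMDiffOn_of_mem_contDiffGroupoid h1)
    exact contMDiffOn_iff_contDiffOn.1 h2
  exact c'.split.contDiff.comp_contDiffOn
    (h.comp c.split.symm.contDiff.contDiffOn (fun q hq => hq))

theorem contDiff_id_prod : ContDiff ℝ ∞ (fun z : (Rn n × Rn m) × (Rn n →L[ℝ] Rn m) =>
    (ContinuousLinearMap.id ℝ (Rn n)).prod z.2) := by
  have h : ContDiff ℝ ∞ (fun z : (Rn n × Rn m) × (Rn n →L[ℝ] Rn m) =>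
      ContinuousLinearMap.inl ℝ (Rn n) (Rn m) +
        (ContinuousLinearMap.inr ℝ (Rn n) (Rn m)).comp z.2) :=
    contDiff_const.add (contDiff_const.clm_comp contDiff_snd)
  convert h using 2 with z
  ext x <;> simp

theorem contDiffOn_transitionFst (c c' : DividedChart n m E) :
    ContDiffOn ℝ ∞ (transitionFst c c') (transitionSource c c' ×ˢ univ) := by
  have h : ContDiffOn ℝ ∞ (fun z : (Rn n × Rn m) × (Rn n →L[ℝ] Rn m) =>
      fderiv ℝ (transitionMap c c') z.1) (transitionSource c c' ×ˢ univ) :=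
    ((contDiffOn_transitionMap c c').fderiv_of_isOpen (isOpen_transitionSource c c')
      (m := ∞) (by simp)).comp contDiffOn_fst (fun z hz => hz.1)
  exact contDiffOn_const.clm_comp (h.clm_comp contDiff_id_prod.contDiffOn)

theorem contDiffOn_transitionSnd (c c' : DividedChart n m E) :
    ContDiffOn ℝ ∞ (transitionSnd c c') (transitionSource c c' ×ˢ univ) := by
  have h : ContDiffOn ℝ ∞ (fun z : (Rn n × Rn m) × (Rn n →L[ℝ] Rn m) =>
      fderiv ℝ (transitionMap c c') z.1) (transitionSource c c' ×ˢ univ) :=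
    ((contDiffOn_transitionMap c c').fderiv_of_isOpen (isOpen_transitionSource c c')
      (m := ∞) (by simp)).comp contDiffOn_fst (fun z hz => hz.1)
  exact contDiffOn_const.clm_comp (h.clm_comp contDiff_id_prod.contDiffOn)

theorem diff_eq_comp (c c' : DividedChart n m E) {p : E} (hp : p ∈ c.chart.source)
    (hp' : p ∈ c'.chart.source) (v : TangentSpace 𝓘(ℝ, Rn (n + m)) p) :
    c'.diff p v = fderiv ℝ (transitionMap c c') (c.coord p) (c.diff p v) := by
  have e : c.chart.symm (c.split.symm (c.coord p)) = p := by
    simpa [DividedChart.coord] using c.chart.left_inv hp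
  have hmem : c.coord p ∈ transitionSource c c' := by
    refine ⟨?_, ?_⟩
    · simpa [DividedChart.coord] using c.chart.map_source hp
    · change c.chart.symm (c.split.symm (c.coord p)) ∈ c'.chart.source
      rwa [e]
  have hd : ∀ d : DividedChart n m E, p ∈ d.chart.source →
      HasMFDerivAt 𝓘(ℝ, Rn (n + m)) 𝓘(ℝ, Rn n × Rn m) d.coord p (d.diff p) := by
    intro d hd
    have h := mdifferentiable_of_mem_atlas (I := 𝓘(ℝ, Rn (n + m))) d.mem
    exact (d.split.hasFDerivAt.hasMFDerivAt).comp p (h.mdifferentiableAt hd).hasMFDerivAt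
  have ht : HasFDerivAt (transitionMap c c') (fderiv ℝ (transitionMap c c') (c.coord p))
      (c.coord p) :=
    (((contDiffOn_transitionMap c c').contDiffAt
      ((isOpen_transitionSource c c').mem_nhds hmem)).differentiableAt (by simp)).hasFDerivAt
  have h1 := ht.hasMFDerivAt.comp p (hd c hp)
  have h2 : HasMFDerivAt 𝓘(ℝ, Rn (n + m)) 𝓘(ℝ, Rn n × Rn m) c'.coord p
      ((fderiv ℝ (transitionMap c c') (c.coord p)).comp (c.diff p)) := by
    refine h1.congr_of_eventuallyEq ?_
    filter_upwards [c.chart.open_source.mem_nhds hp] with x hx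
    simp [transitionMap, DividedChart.coord, c.chart.left_inv hx]
  exact DFunLike.congr_fun (hasMFDerivAt_unique (hd c' hp') h2) v

theorem map_diff_eq_range (c c' : DividedChart n m E) {θ : JetSub n m E} (hθ : θ ∈ c.domain)
    (hp' : θ.pt ∈ c'.chart.source) :
    θ.plane.map (c'.diff θ.pt : TangentSpace 𝓘(ℝ, Rn (n + m)) θ.pt →ₗ[ℝ] Rn n × Rn m) =
      LinearMap.range (((transitionFst c c' (c.jetChart θ)).prod
        (transitionSnd c c' (c.jetChart θ)) : Rn n →L[ℝ] Rn n × Rn m) :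
          Rn n →ₗ[ℝ] Rn n × Rn m) := by
  have h1 := c.map_diff_plane hθ
  have h2 : (c'.diff θ.pt : TangentSpace 𝓘(ℝ, Rn (n + m)) θ.pt →ₗ[ℝ] Rn n × Rn m) =
      (fderiv ℝ (transitionMap c c') (c.coord θ.pt) : Rn n × Rn m →ₗ[ℝ] Rn n × Rn m) ∘ₗ
        (c.diff θ.pt : TangentSpace 𝓘(ℝ, Rn (n + m)) θ.pt →ₗ[ℝ] Rn n × Rn m) := by
    ext1 v
    exact diff_eq_comp c c' hθ.1 hp' v
  rw [h2, Submodule.map_comp, h1, LinearMap.graph_eq_range_prod, ← LinearMap.range_comp]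
  rfl

theorem range_prod_eq_graph {P : Rn n →L[ℝ] Rn n} {Q B : Rn n →L[ℝ] Rn m}
    (h : LinearMap.range ((P.prod Q : Rn n →L[ℝ] Rn n × Rn m) : Rn n →ₗ[ℝ] Rn n × Rn m) =
      (B : Rn n →ₗ[ℝ] Rn m).graph) : IsUnit P := by
  have hs : Function.Surjective P := by
    intro y
    have : (y, B y) ∈ (B : Rn n →ₗ[ℝ] Rn m).graph := by simp [LinearMap.mem_graph_iff]
    rw [← h] at this
    obtain ⟨x, hx⟩ := this
    exact ⟨x, (Prod.ext_iff.1 hx).1⟩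
  have hi : Function.Injective P := by
    exact (LinearMap.injective_iff_surjective (f := (P : Rn n →ₗ[ℝ] Rn n))).2 hs
  let e := (LinearEquiv.ofBijective (P : Rn n →ₗ[ℝ] Rn n) ⟨hi, hs⟩).toContinuousLinearEquiv
  exact ⟨ContinuousLinearEquiv.toUnit e, by ext1 x; rfl⟩

theorem range_prod_of_isUnit {P : Rn n →L[ℝ] Rn n} (Q : Rn n →L[ℝ] Rn m) (h : IsUnit P) :
    LinearMap.range ((P.prod Q : Rn n →L[ℝ] Rn n × Rn m) : Rn n →ₗ[ℝ] Rn n × Rn m) =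
      ((Q.comp (Ring.inverse P) : Rn n →L[ℝ] Rn m) : Rn n →ₗ[ℝ] Rn m).graph := by
  have h1 : ∀ x, P (Ring.inverse P x) = x := fun x =>
    DFunLike.congr_fun (Ring.mul_inverse_cancel P h) x
  have h2 : ∀ x, Ring.inverse P (P x) = x := fun x =>
    DFunLike.congr_fun (Ring.inverse_mul_cancel P h) x
  ext ⟨a, b⟩
  simp only [LinearMap.mem_graph_iff, LinearMap.mem_range]
  constructor
  · rintro ⟨x, hx⟩
    obtain ⟨rfl, rfl⟩ := Prod.ext_iff.1 hx
    simp [h2]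
  · intro hb
    refine ⟨Ring.inverse P a, ?_⟩
    ext1
    · exact h1 a
    · exact hb.symm

theorem mem_domain_iff (c c' : DividedChart n m E) {θ : JetSub n m E} (hθ : θ ∈ c.domain)
    (hp' : θ.pt ∈ c'.chart.source) :
    θ ∈ c'.domain ↔ IsUnit (transitionFst c c' (c.jetChart θ)) := by
  constructor
  · rintro ⟨-, B, hB⟩
    rw [map_diff_eq_range c c' hθ hp'] at hB
    exact range_prod_eq_graph hB
  · intro h
    exact ⟨hp', _, (map_diff_eq_range c c' hθ hp').trans (range_prod_of_isUnit _ h)⟩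

theorem jetSlope_eq (c c' : DividedChart n m E) {θ : JetSub n m E} (hθ : θ ∈ c.domain)
    (hθ' : θ ∈ c'.domain) :
    c'.jetSlope θ = (transitionSnd c c' (c.jetChart θ)).comp
      (Ring.inverse (transitionFst c c' (c.jetChart θ))) := by
  rw [DividedChart.jetSlope, map_diff_eq_range c c' hθ hθ'.1,
    range_prod_of_isUnit _ ((mem_domain_iff c c' hθ hθ'.1).1 hθ'), graphSlope_graph]

theorem jetChart_trans_source (c c' : DividedChart n m E) :
    (c.jetChart.symm.trans c'.jetChart).source =
      (transitionSource c c' ×ˢ univ) ∩ transitionFst c c' ⁻¹' {P | IsUnit P} := by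
  ext z
  have key : ∀ hz : z ∈ c.jetChart.target, c.jetChart.symm z ∈ c.domain ∧
      c.jetChart (c.jetChart.symm z) = z ∧
      (c.jetChart.symm z).pt = c.chart.symm (c.split.symm z.1) := fun hz =>
    ⟨c.jetChart.map_target hz, c.jetChart.right_inv hz, JetSub.pt_ofSubmodule _ _⟩
  constructor
  · rintro ⟨hz, hz'⟩
    obtain ⟨h1, h2, h3⟩ := key hz
    have hz'' : c.jetChart.symm z ∈ c'.domain := hz'
    refine ⟨⟨⟨hz, ?_⟩, trivial⟩, ?_⟩
    · change c.chart.symm (c.split.symm z.1) ∈ c'.chart.source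
      rw [← h3]; exact hz''.1
    · have := (mem_domain_iff c c' h1 hz''.1).1 hz''
      rwa [h2] at this
  · rintro ⟨⟨⟨hz, hz'⟩, -⟩, hu⟩
    obtain ⟨h1, h2, h3⟩ := key hz
    refine ⟨hz, ?_⟩
    change c.jetChart.symm z ∈ c'.domain
    rw [mem_domain_iff c c' h1 (by rw [h3]; exact hz'), h2]
    exact hu

theorem jetChart_trans_apply (c c' : DividedChart n m E)
    {z : (Rn n × Rn m) × (Rn n →L[ℝ] Rn m)} (hz : z ∈ (c.jetChart.symm.trans c'.jetChart).source) :
    (c.jetChart.symm.trans c'.jetChart) z = (transitionMap c c' z.1,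
      (transitionSnd c c' z).comp (Ring.inverse (transitionFst c c' z))) := by
  have h1 : c.jetChart.symm z ∈ c.domain := c.jetChart.map_target hz.1
  have h2 : c.jetChart (c.jetChart.symm z) = z := c.jetChart.right_inv hz.1
  have h3 : (c.jetChart.symm z).pt = c.chart.symm (c.split.symm z.1) :=
    JetSub.pt_ofSubmodule _ _
  have h4 := jetSlope_eq c c' h1 hz.2
  rw [h2] at h4
  refine Prod.ext ?_ h4
  change c'.coord (c.jetChart.symm z).pt = _
  rw [h3]; rfl

theorem isOpen_jetChart_trans_source (c c' : DividedChart n m E) :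
    IsOpen (c.jetChart.symm.trans c'.jetChart).source := by
  rw [jetChart_trans_source]
  exact (contDiffOn_transitionFst c c').continuousOn.isOpen_inter_preimage
    ((isOpen_transitionSource c c').prod isOpen_univ) Units.isOpen

theorem contDiffOn_jetChart_trans (c c' : DividedChart n m E) :
    ContDiffOn ℝ ∞ (c.jetChart.symm.trans c'.jetChart)
      (c.jetChart.symm.trans c'.jetChart).source := by
  have hsub : (c.jetChart.symm.trans c'.jetChart).source ⊆ transitionSource c c' ×ˢ univ := by
    rw [jetChart_trans_source]; exact inter_subset_left
  have h : ContDiffOn ℝ ∞ (fun z => (transitionMap c c' z.1,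
      (transitionSnd c c' z).comp (Ring.inverse (transitionFst c c' z))))
      (c.jetChart.symm.trans c'.jetChart).source := by
    refine ContDiffOn.prodMk ?_ ?_
    · exact (contDiffOn_transitionMap c c').comp contDiffOn_fst (fun z hz => (hsub hz).1)
    · refine ((contDiffOn_transitionSnd c c').mono hsub).clm_comp ?_
      intro z hz
      have hu : IsUnit (transitionFst c c' z) := by
        rw [jetChart_trans_source] at hz; exact hz.2
      obtain ⟨u, hu⟩ := hu
      have h3 := contDiffAt_ringInverse ℝ (n := ∞) u
      rw [hu] at h3
      exact h3.comp_contDiffWithinAt z (((contDiffOn_transitionFst c c').mono hsub) z hz)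
  exact h.congr fun z hz => jetChart_trans_apply c c' hz

theorem exists_dividedChart (θ : JetSub n m E) : ∃ c : DividedChart n m E,
    c.chart = chartAt (Rn (n + m)) θ.pt ∧
    θ.plane.map (c.diff θ.pt : TangentSpace 𝓘(ℝ, Rn (n + m)) θ.pt →ₗ[ℝ] Rn n × Rn m) =
      (0 : Rn n →ₗ[ℝ] Rn m).graph := by
  have hp := mem_chart_source (Rn (n + m)) θ.pt
  have h := mdifferentiable_of_mem_atlas (I := 𝓘(ℝ, Rn (n + m)))
    (chart_mem_atlas (Rn (n + m)) θ.pt)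
  have hb := (h.mfderiv hp).bijective
  let T : TangentSpace 𝓘(ℝ, Rn (n + m)) θ.pt →ₗ[ℝ] Rn (n + m) :=
    (mfderiv 𝓘(ℝ, Rn (n + m)) 𝓘(ℝ, Rn (n + m)) (chartAt (Rn (n + m)) θ.pt) θ.pt).toLinearMap
  have hT : Function.Injective T := hb.1
  obtain ⟨L, hL⟩ := exists_splitting (θ.plane.map T)
    ((LinearEquiv.finrank_eq (Submodule.equivMapOfInjective T hT θ.plane)).symm.trans
      θ.finrank_plane)
  refine ⟨⟨chartAt (Rn (n + m)) θ.pt, chart_mem_atlas _ _, L⟩, rfl, ?_⟩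
  rw [← Submodule.map_comp] at hL
  exact hL

/-- A divided chart at `θ = (p, W)`: the preferred chart of `E` at `p`, split in such a way that
`W` becomes `ℝ^n × 0`. -/
def preferredChart (θ : JetSub n m E) : DividedChart n m E := (exists_dividedChart θ).choose

theorem preferredChart_chart (θ : JetSub n m E) :
    (preferredChart θ).chart = chartAt (Rn (n + m)) θ.pt := (exists_dividedChart θ).choose_spec.1

theorem map_preferredChart (θ : JetSub n m E) :
    θ.plane.map ((preferredChart θ).diff θ.pt :
      TangentSpace 𝓘(ℝ, Rn (n + m)) θ.pt →ₗ[ℝ] Rn n × Rn m) =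
      (0 : Rn n →ₗ[ℝ] Rn m).graph := (exists_dividedChart θ).choose_spec.2

theorem mem_preferredChart_domain (θ : JetSub n m E) : θ ∈ (preferredChart θ).domain := by
  refine ⟨?_, 0, map_preferredChart θ⟩
  rw [preferredChart_chart]
  exact mem_chart_source _ _

/-- The atlas of `J¹(E,n)` formed by the charts induced by the divided charts of `E`. -/
def jetCore : ChartedSpaceCore ((Rn n × Rn m) × (Rn n →L[ℝ] Rn m)) (JetSub n m E) where
  atlas := range fun c : DividedChart n m E => c.jetChart
  chartAt θ := (preferredChart θ).jetChart
  mem_chart_source θ := mem_preferredChart_domain θ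
  chart_mem_atlas θ := mem_range_self _
  open_source := by
    rintro _ _ ⟨c, rfl⟩ ⟨c', rfl⟩
    exact isOpen_jetChart_trans_source c c'
  continuousOn_toFun := by
    rintro _ _ ⟨c, rfl⟩ ⟨c', rfl⟩
    exact (contDiffOn_jetChart_trans c c').continuousOn

instance : TopologicalSpace (JetSub n m E) := jetCore.toTopologicalSpace

instance : ChartedSpace ((Rn n × Rn m) × (Rn n →L[ℝ] Rn m)) (JetSub n m E) :=
  jetCore.toChartedSpace

/-- The chart of `J¹(E,n)` induced by a divided chart, as a homeomorphism. -/
def DividedChart.jetHomeo (c : DividedChart n m E) :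
    OpenPartialHomeomorph (JetSub n m E) ((Rn n × Rn m) × (Rn n →L[ℝ] Rn m)) :=
  jetCore.openPartialHomeomorph c.jetChart (mem_range_self c)

theorem mem_atlas_jetSub_iff
    {e : OpenPartialHomeomorph (JetSub n m E) ((Rn n × Rn m) × (Rn n →L[ℝ] Rn m))} :
    e ∈ atlas ((Rn n × Rn m) × (Rn n →L[ℝ] Rn m)) (JetSub n m E) ↔
      ∃ c : DividedChart n m E, e = c.jetHomeo := by
  change e ∈ ⋃ (e : PartialEquiv (JetSub n m E) ((Rn n × Rn m) × (Rn n →L[ℝ] Rn m)))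
    (he : e ∈ jetCore.atlas), {jetCore.openPartialHomeomorph e he} ↔ _
  simp only [mem_iUnion, mem_singleton_iff]
  constructor
  · rintro ⟨_, ⟨c, rfl⟩, h⟩; exact ⟨c, h⟩
  · rintro ⟨c, h⟩; exact ⟨_, mem_range_self c, h⟩

instance : IsManifold 𝓘(ℝ, (Rn n × Rn m) × (Rn n →L[ℝ] Rn m)) ∞ (JetSub n m E) := by
  refine isManifold_of_contDiffOn _ _ _ ?_
  intro e e' he he'
  obtain ⟨c, rfl⟩ := mem_atlas_jetSub_iff.1 he
  obtain ⟨c', rfl⟩ := mem_atlas_jetSub_iff.1 he'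
  have h := contDiffOn_jetChart_trans c c'
  simpa using! h

theorem DividedChart.contMDiffOn_jetHomeo (c : DividedChart n m E) :
    ContMDiffOn 𝓘(ℝ, (Rn n × Rn m) × (Rn n →L[ℝ] Rn m))
      𝓘(ℝ, (Rn n × Rn m) × (Rn n →L[ℝ] Rn m)) ∞ c.jetHomeo c.domain :=
  contMDiffOn_of_mem_maximalAtlas
    (IsManifold.subset_maximalAtlas (mem_atlas_jetSub_iff.2 ⟨c, rfl⟩))

theorem contMDiff_pt : ContMDiff 𝓘(ℝ, (Rn n × Rn m) × (Rn n →L[ℝ] Rn m)) 𝓘(ℝ, Rn (n + m)) ∞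
    (JetSub.pt : JetSub n m E → E) := by
  intro θ
  have hθ := mem_preferredChart_domain θ
  have h1 : ContMDiffAt 𝓘(ℝ, (Rn n × Rn m) × (Rn n →L[ℝ] Rn m))
      𝓘(ℝ, (Rn n × Rn m) × (Rn n →L[ℝ] Rn m)) ∞ (preferredChart θ).jetHomeo θ :=
    (preferredChart θ).contMDiffOn_jetHomeo.contMDiffAt
      ((preferredChart θ).jetHomeo.open_source.mem_nhds hθ)
  have h2 : ContDiff ℝ ∞ (fun z : (Rn n × Rn m) × (Rn n →L[ℝ] Rn m) =>
    (preferredChart θ).split.symm z.1) :=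
    (preferredChart θ).split.symm.contDiff.comp contDiff_fst
  have h3 : ContMDiffAt 𝓘(ℝ, Rn (n + m)) 𝓘(ℝ, Rn (n + m)) ∞ (preferredChart θ).chart.symm
      ((preferredChart θ).chart θ.pt) :=
    (contMDiffOn_symm_of_mem_maximalAtlas (IsManifold.subset_maximalAtlas
      (preferredChart θ).mem)).contMDiffAt
      ((preferredChart θ).chart.open_target.mem_nhds ((preferredChart θ).chart.map_source hθ.1))
  have h4 := h2.contMDiff.contMDiffAt.comp θ h1
  have h5 := ContMDiffAt.comp_of_eq (x := θ) h3 h4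
    (by exact (preferredChart θ).split.symm_apply_apply _)
  refine h5.congr_of_eventuallyEq ?_
  filter_upwards [(preferredChart θ).jetHomeo.open_source.mem_nhds hθ] with θ' hθ'
  have e : (preferredChart θ).split.symm ((preferredChart θ).coord θ'.pt) =
    (preferredChart θ).chart θ'.pt := (preferredChart θ).split.symm_apply_apply _
  change θ'.pt = (preferredChart θ).chart.symm
    ((preferredChart θ).split.symm ((preferredChart θ).coord θ'.pt))
  rw [e, (preferredChart θ).chart.left_inv hθ'.1]

/-- The projection `π_{1,0} : J¹(E,n) → E`. -/
def jetProj : C^∞⟮𝓘(ℝ, (Rn n × Rn m) × (Rn n →L[ℝ] Rn m)), JetSub n m E;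
    𝓘(ℝ, Rn (n + m)), E⟯ := ⟨JetSub.pt, contMDiff_pt⟩

/-! ### The bundle `H^{1,0}` -/

/-- The fibre of `H^{1,0} = {(θ, v) : v ∈ R_θ}`, where `R_θ ⊂ T_p E` is the plane `θ`. -/
def Horiz (θ : JetSub n m E) : Type := θ.plane

instance (θ : JetSub n m E) : AddCommGroup (Horiz θ) := θ.plane.addCommGroup
instance (θ : JetSub n m E) : Module ℝ (Horiz θ) := inferInstanceAs (Module ℝ θ.plane)
instance (θ : JetSub n m E) : TopologicalSpace (Horiz θ) :=
  inferInstanceAs (TopologicalSpace θ.plane)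
instance (θ : JetSub n m E) : IsTopologicalAddGroup (Horiz θ) :=
  inferInstanceAs (IsTopologicalAddGroup θ.plane)
instance (θ : JetSub n m E) : ContinuousSMul ℝ (Horiz θ) :=
  inferInstanceAs (ContinuousSMul ℝ θ.plane)

/-- The inclusion `H^{1,0}_θ → T_p E`. -/
def Horiz.incl (θ : JetSub n m E) : Horiz θ →L[ℝ] TangentSpace 𝓘(ℝ, Rn (n + m)) θ.pt :=
  θ.plane.subtypeL

/-- The components `du^λ` of a vector of the plane in a divided chart. -/
def DividedChart.horizCoord (c : DividedChart n m E) (θ : JetSub n m E) : Horiz θ →L[ℝ] Rn n :=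
  (ContinuousLinearMap.fst ℝ (Rn n) (Rn m)).comp ((c.diff θ.pt).comp (Horiz.incl θ))

theorem DividedChart.diff_incl (c : DividedChart n m E) {θ : JetSub n m E} (h : θ ∈ c.domain)
    (y : Horiz θ) : c.diff θ.pt (Horiz.incl θ y) = (c.horizCoord θ y, c.jetSlope θ (c.horizCoord θ y)) := by
  have : c.diff θ.pt (Horiz.incl θ y) ∈ (c.jetSlope θ : Rn n →ₗ[ℝ] Rn m).graph := by
    rw [← c.map_diff_plane h]
    exact Submodule.mem_map_of_mem y.2
  rw [LinearMap.mem_graph_iff] at this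
  exact Prod.ext rfl this

theorem DividedChart.horizCoord_bijective (c : DividedChart n m E) {θ : JetSub n m E}
    (h : θ ∈ c.domain) : Function.Bijective (c.horizCoord θ) := by
  constructor
  · intro y y' hy
    have h1 := c.diff_incl h y
    rw [hy, ← c.diff_incl h y'] at h1
    exact Subtype.val_injective ((c.diff_bijective h.1).1 h1)
  · intro z
    have : (z, c.jetSlope θ z) ∈ (c.jetSlope θ : Rn n →ₗ[ℝ] Rn m).graph := by
      simp [LinearMap.mem_graph_iff]
    rw [← c.map_diff_plane h] at this
    obtain ⟨y, hy, hyz⟩ := this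
    exact ⟨⟨y, hy⟩, (Prod.ext_iff.1 hyz).1⟩

/-- The components `du^λ` as an isomorphism. -/
def DividedChart.horizEquiv (c : DividedChart n m E) {θ : JetSub n m E} (h : θ ∈ c.domain) :
    Horiz θ ≃ₗ[ℝ] Rn n :=
  LinearEquiv.ofBijective (c.horizCoord θ : Horiz θ →ₗ[ℝ] Rn n) (c.horizCoord_bijective h)

open Classical in
/-- The local trivialization of `H^{1,0}` given by the components `du^λ` in a divided chart. -/
def DividedChart.horizTriv (c : DividedChart n m E) :
    Pretrivialization (Rn n) (π (Rn n) (Horiz : JetSub n m E → Type)) where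
  toFun w := (w.1, c.horizCoord w.1 w.2)
  invFun z := ⟨z.1, if h : z.1 ∈ c.domain then (c.horizEquiv h).symm z.2 else 0⟩
  source := π (Rn n) (Horiz : JetSub n m E → Type) ⁻¹' c.domain
  target := c.domain ×ˢ univ
  map_source' w hw := ⟨hw, trivial⟩
  map_target' z hz := hz.1
  left_inv' := by
    rintro ⟨θ, y⟩ (h : θ ∈ c.domain)
    simp only [dif_pos h]
    congr 1
    exact (c.horizEquiv h).symm_apply_apply y
  right_inv' := by
    rintro ⟨θ, z⟩ ⟨h, -⟩
    have h : θ ∈ c.domain := h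
    simp only [dif_pos h]
    congr 1
    exact (c.horizEquiv h).apply_symm_apply z
  open_target := c.jetHomeo.open_source.prod isOpen_univ
  baseSet := c.domain
  open_baseSet := c.jetHomeo.open_source
  source_eq := rfl
  target_eq := rfl
  proj_toFun _ _ := rfl

theorem contMDiffOn_horizCoordChange (c c' : DividedChart n m E) :
    ContMDiffOn 𝓘(ℝ, (Rn n × Rn m) × (Rn n →L[ℝ] Rn m)) 𝓘(ℝ, Rn n →L[ℝ] Rn n) ∞
      (fun θ => transitionFst c c' (c.jetChart θ)) (c.domain ∩ c'.domain) := by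
  refine (contDiffOn_transitionFst c c').contMDiffOn.comp
    (c.contMDiffOn_jetHomeo.mono inter_subset_left) ?_
  rintro θ ⟨h, h'⟩
  have hs : c.jetChart.symm (c.jetChart θ) = θ := c.jetChart.left_inv h
  have : c.jetChart θ ∈ (c.jetChart.symm.trans c'.jetChart).source := by
    refine ⟨c.jetChart.map_source h, ?_⟩
    change c.jetChart.symm (c.jetChart θ) ∈ c'.domain
    rwa [hs]
  rw [jetChart_trans_source] at this
  exact this.1

open Classical in
theorem horizCoordChange_apply (c c' : DividedChart n m E) {θ : JetSub n m E}
    (h : θ ∈ c.domain ∩ c'.domain) (v : Rn n) :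
    transitionFst c c' (c.jetChart θ) v = (c'.horizTriv ⟨θ, c.horizTriv.symm θ v⟩).2 := by
  have h1 : c.horizTriv.symm θ v = (c.horizEquiv h.1).symm v := by
    have hs := c.horizTriv.mk_symm (b := θ) h.1 v
    have hs2 : c.horizTriv.toPartialEquiv.symm (θ, v) = ⟨θ, (c.horizEquiv h.1).symm v⟩ := by
      refine Eq.trans (b := (⟨θ, if h : θ ∈ c.domain then (c.horizEquiv h).symm v else 0⟩ :
        TotalSpace (Rn n) (Horiz : JetSub n m E → Type))) rfl ?_
      rw [dif_pos h.1]
    rw [hs2] at hs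
    simpa using hs
  have h2 : c.horizCoord θ ((c.horizEquiv h.1).symm v) = v :=
    (c.horizEquiv h.1).apply_symm_apply v
  rw [h1]
  change _ = (c'.diff θ.pt (Horiz.incl θ ((c.horizEquiv h.1).symm v))).1
  rw [diff_eq_comp c c' h.1.1 h.2.1, c.diff_incl h.1, h2]
  rfl

/-- `H^{1,0}` as a vector bundle over `J¹(E,n)`. -/
def horizPrebundle : VectorPrebundle ℝ (Rn n) (Horiz : JetSub n m E → Type) where
  pretrivializationAtlas := range fun c : DividedChart n m E => c.horizTriv
  pretrivialization_linear' := by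
    rintro _ ⟨c, rfl⟩
    exact ⟨fun θ h => ⟨(c.horizCoord θ).map_add, (c.horizCoord θ).map_smul⟩⟩
  pretrivializationAt θ := (preferredChart θ).horizTriv
  mem_base_pretrivializationAt θ := mem_preferredChart_domain θ
  pretrivialization_mem_atlas θ := mem_range_self _
  exists_coordChange := by
    rintro _ ⟨c, rfl⟩ _ ⟨c', rfl⟩
    refine ⟨fun θ => transitionFst c c' (c.jetChart θ), ?_, ?_⟩
    · exact (contMDiffOn_horizCoordChange c c').continuousOn
    · intro θ h v
      exact horizCoordChange_apply c c' h v
  totalSpaceMk_isInducing θ := by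
    have : FiniteDimensional ℝ (Horiz θ) := (((preferredChart θ).horizEquiv
      (mem_preferredChart_domain θ)).symm).finiteDimensional
    have : T2Space (TangentSpace 𝓘(ℝ, Rn (n + m)) θ.pt) :=
      inferInstanceAs (T2Space (Rn (n + m)))
    have : T2Space (Horiz θ) := inferInstanceAs (T2Space θ.plane)
    have h1 := (((preferredChart θ).horizEquiv
      (mem_preferredChart_domain θ)).toContinuousLinearEquiv).toHomeomorph.isInducing
    exact (isInducing_const_prod (x := θ)).2 h1

instance : TopologicalSpace (TotalSpace (Rn n) (Horiz : JetSub n m E → Type)) :=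
  horizPrebundle.totalSpaceTopology

instance : FiberBundle (Rn n) (Horiz : JetSub n m E → Type) := horizPrebundle.toFiberBundle

instance : VectorBundle ℝ (Rn n) (Horiz : JetSub n m E → Type) := horizPrebundle.toVectorBundle

instance : ContMDiffVectorBundle ∞ (Rn n) (Horiz : JetSub n m E → Type)
    𝓘(ℝ, (Rn n × Rn m) × (Rn n →L[ℝ] Rn m)) := by
  have : horizPrebundle.IsContMDiff (n := ∞) 𝓘(ℝ, (Rn n × Rn m) × (Rn n →L[ℝ] Rn m))
      (E := (Horiz : JetSub n m E → Type)) := by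
    refine ⟨?_⟩
    rintro _ ⟨c, rfl⟩ _ ⟨c', rfl⟩
    exact ⟨_, contMDiffOn_horizCoordChange c c', fun θ h v => horizCoordChange_apply c c' h v⟩
  exact horizPrebundle.contMDiffVectorBundle _

end JetSpace

/-! ### Pull-back and homomorphism bundles -/

section PullbackBundle

variable {EB : Type*} [NormedAddCommGroup EB] [NormedSpace ℝ EB]
  {HB : Type*} [TopologicalSpace HB] {I : ModelWithCorners ℝ EB HB}
  {B : Type*} [TopologicalSpace B] [ChartedSpace HB B]
  {EP : Type*} [NormedAddCommGroup EP] [NormedSpace ℝ EP]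
  {HP : Type*} [TopologicalSpace HP] {IP : ModelWithCorners ℝ EP HP}
  {P : Type*} [TopologicalSpace P] [ChartedSpace HP P]
  (f : C^∞⟮IP, P; I, B⟯) (F : Type*) [NormedAddCommGroup F] [NormedSpace ℝ F]
  (V : B → Type*)

/-- The fibre of the pull-back bundle `f^*V`. -/
def PullFibre (p : P) : Type _ := V (f p)

instance [∀ x, AddCommGroup (V x)] (p : P) : AddCommGroup (PullFibre f V p) :=
  inferInstanceAs (AddCommGroup (V (f p)))
instance [∀ x, AddCommGroup (V x)] [∀ x, Module ℝ (V x)] (p : P) : Module ℝ (PullFibre f V p) :=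
  inferInstanceAs (Module ℝ (V (f p)))
instance [∀ x, TopologicalSpace (V x)] (p : P) : TopologicalSpace (PullFibre f V p) :=
  inferInstanceAs (TopologicalSpace (V (f p)))
instance [∀ x, AddCommGroup (V x)] [∀ x, TopologicalSpace (V x)] [∀ x, IsTopologicalAddGroup (V x)]
    (p : P) : IsTopologicalAddGroup (PullFibre f V p) :=
  inferInstanceAs (IsTopologicalAddGroup (V (f p)))
instance [∀ x, AddCommGroup (V x)] [∀ x, Module ℝ (V x)] [∀ x, TopologicalSpace (V x)]
    [∀ x, ContinuousSMul ℝ (V x)] (p : P) : ContinuousSMul ℝ (PullFibre f V p) :=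
  inferInstanceAs (ContinuousSMul ℝ (V (f p)))

variable [TopologicalSpace (TotalSpace F V)]

instance : TopologicalSpace (TotalSpace F (PullFibre f V)) :=
  inferInstanceAs (TopologicalSpace (TotalSpace F ((f : P → B) *ᵖ V)))

variable [∀ x, AddCommGroup (V x)] [∀ x, Module ℝ (V x)] [∀ x, TopologicalSpace (V x)]
  [FiberBundle F V]

instance : FiberBundle F (PullFibre f V) :=
  inferInstanceAs (FiberBundle F ((f : P → B) *ᵖ V))

variable [VectorBundle ℝ F V]

instance : VectorBundle ℝ F (PullFibre f V) :=
  inferInstanceAs (VectorBundle ℝ F ((f : P → B) *ᵖ V))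

instance [ContMDiffVectorBundle ∞ F V I] : ContMDiffVectorBundle ∞ F (PullFibre f V) IP :=
  ContMDiffVectorBundle.pullback F V IP f

theorem PullFibre.symmL_trivializationAt (p : P) (z : F) :
    (trivializationAt F (PullFibre f V) p).symmL ℝ p z =
      (trivializationAt F V (f p)).symmL ℝ (f p) z := by
  have hq : f p ∈ (trivializationAt F V (f p)).baseSet :=
    FiberBundle.mem_baseSet_trivializationAt' (f p)
  have hq' : p ∈ (trivializationAt F (PullFibre f V) p).baseSet := hq
  rw [Trivialization.symmL_apply _ hq, Trivialization.symmL_apply _ hq']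
  apply ((trivializationAt F V (f p)).continuousLinearEquivAt ℝ (f p) hq).injective
  have a1 := (trivializationAt F V (f p)).apply_mk_symm hq z
  have a2 := (trivializationAt F (PullFibre f V) p).apply_mk_symm hq' z
  exact (congrArg Prod.snd a2).trans (congrArg Prod.snd a1).symm

end PullbackBundle

section HomBundle

variable {B : Type*} (F₁ F₂ : Type*) [NormedAddCommGroup F₁] [NormedSpace ℝ F₁]
  [NormedAddCommGroup F₂] [NormedSpace ℝ F₂] (V₁ V₂ : B → Type*)
  [∀ x, AddCommGroup (V₁ x)] [∀ x, Module ℝ (V₁ x)] [∀ x, TopologicalSpace (V₁ x)]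
  [∀ x, AddCommGroup (V₂ x)] [∀ x, Module ℝ (V₂ x)] [∀ x, TopologicalSpace (V₂ x)]

/-- The fibre of the bundle `Hom(V₁, V₂) = V₁^* ⊗ V₂`. -/
def HomFibre (x : B) : Type _ := V₁ x →L[ℝ] V₂ x

variable [∀ x, IsTopologicalAddGroup (V₂ x)] [∀ x, ContinuousSMul ℝ (V₂ x)]

instance (x : B) : AddCommGroup (HomFibre V₁ V₂ x) :=
  inferInstanceAs (AddCommGroup (V₁ x →L[ℝ] V₂ x))
instance (x : B) : Module ℝ (HomFibre V₁ V₂ x) := inferInstanceAs (Module ℝ (V₁ x →L[ℝ] V₂ x))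
instance (x : B) : TopologicalSpace (HomFibre V₁ V₂ x) :=
  inferInstanceAs (TopologicalSpace (V₁ x →L[ℝ] V₂ x))
instance (x : B) : IsTopologicalAddGroup (HomFibre V₁ V₂ x) :=
  inferInstanceAs (IsTopologicalAddGroup (V₁ x →L[ℝ] V₂ x))
instance (x : B) : ContinuousSMul ℝ (HomFibre V₁ V₂ x) :=
  inferInstanceAs (ContinuousSMul ℝ (V₁ x →L[ℝ] V₂ x))

variable [TopologicalSpace B]
  [TopologicalSpace (TotalSpace F₁ V₁)] [FiberBundle F₁ V₁] [VectorBundle ℝ F₁ V₁]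
  [TopologicalSpace (TotalSpace F₂ V₂)] [FiberBundle F₂ V₂] [VectorBundle ℝ F₂ V₂]
  [∀ x, IsTopologicalAddGroup (V₁ x)] [∀ x, ContinuousSMul ℝ (V₁ x)]

instance : TopologicalSpace (TotalSpace (F₁ →L[ℝ] F₂) (HomFibre V₁ V₂)) :=
  inferInstanceAs (TopologicalSpace (TotalSpace (F₁ →L[ℝ] F₂) (fun x => V₁ x →L[ℝ] V₂ x)))
instance : FiberBundle (F₁ →L[ℝ] F₂) (HomFibre V₁ V₂) :=
  inferInstanceAs (FiberBundle (F₁ →L[ℝ] F₂) (fun x => V₁ x →L[ℝ] V₂ x))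
instance : VectorBundle ℝ (F₁ →L[ℝ] F₂) (HomFibre V₁ V₂) :=
  inferInstanceAs (VectorBundle ℝ (F₁ →L[ℝ] F₂) (fun x => V₁ x →L[ℝ] V₂ x))
instance {EB : Type*} [NormedAddCommGroup EB] [NormedSpace ℝ EB]
    {HB : Type*} [TopologicalSpace HB] {I : ModelWithCorners ℝ EB HB} [ChartedSpace HB B]
    [ContMDiffVectorBundle ∞ F₁ V₁ I] [ContMDiffVectorBundle ∞ F₂ V₂ I] :
    ContMDiffVectorBundle ∞ (F₁ →L[ℝ] F₂) (HomFibre V₁ V₂) I :=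
  inferInstanceAs (ContMDiffVectorBundle ∞ (F₁ →L[ℝ] F₂) (fun x => V₁ x →L[ℝ] V₂ x) I)

end HomBundle

/-! ### Linear connections and their vertical projections -/

section Connections

variable {EB : Type*} [NormedAddCommGroup EB] [NormedSpace ℝ EB]
  {HB : Type*} [TopologicalSpace HB] {I : ModelWithCorners ℝ EB HB}
  {B : Type*} [TopologicalSpace B] [ChartedSpace HB B]

/-- The local connection form at `b` of a linear connection, in the preferred local trivialization
at `b`: the linear map `X ↦ X^i Γ_i{}^k{}_j` from `T_b B` to the endomorphisms of the typical
fibre `F`. -/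
abbrev LocalForm (I : ModelWithCorners ℝ EB HB) (F : Type*) [NormedAddCommGroup F]
    [NormedSpace ℝ F] (b : B) : Type _ := TangentSpace I b →ₗ[ℝ] (F →L[ℝ] F)

/-- The local connection forms of the pull-back of a linear connection along `f`. -/
def pullbackForm {F : Type*} [NormedAddCommGroup F] [NormedSpace ℝ F]
    {EP : Type*} [NormedAddCommGroup EP] [NormedSpace ℝ EP]
    {HP : Type*} [TopologicalSpace HP] {IP : ModelWithCorners ℝ EP HP}
    {P : Type*} [TopologicalSpace P] [ChartedSpace HP P] (f : C^∞⟮IP, P; I, B⟯)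
    (A : Π b : B, LocalForm I F b) (p : P) : LocalForm IP F p :=
  A (f p) ∘ₗ (mfderiv IP I f p : TangentSpace IP p →ₗ[ℝ] TangentSpace I (f p))

set_option synthInstance.maxHeartbeats 200000 in
/-- The local connection forms of the linear connection on `V₁^* ⊗ V₂ = Hom(V₁, V₂)` that is the
tensor product of the dual of a connection on `V₁` and of a connection on `V₂`. -/
def homForm {F₁ F₂ : Type*} [NormedAddCommGroup F₁] [NormedSpace ℝ F₁]
    [NormedAddCommGroup F₂] [NormedSpace ℝ F₂]
    (A₁ : Π b : B, LocalForm I F₁ b) (A₂ : Π b : B, LocalForm I F₂ b) (b : B) :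
    LocalForm I (F₁ →L[ℝ] F₂) b :=
  ((ContinuousLinearMap.compL ℝ F₁ F₂ F₂).toLinearMap ∘ₗ A₂ b) -
    ((ContinuousLinearMap.compL ℝ F₁ F₁ F₂).flip.toLinearMap ∘ₗ A₁ b)

variable {F : Type*} [NormedAddCommGroup F] [NormedSpace ℝ F]
  {V : B → Type*} [TopologicalSpace (TotalSpace F V)]
  [∀ x, AddCommGroup (V x)] [∀ x, Module ℝ (V x)] [∀ x, TopologicalSpace (V x)]
  [FiberBundle F V] [VectorBundle ℝ F V]

/-- The section through `f ∈ F` that is constant in the preferred trivialization at `b`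
(extended by zero outside the domain of the trivialization). -/
def constSection (V : B → Type*) [TopologicalSpace (TotalSpace F V)]
    [∀ x, AddCommGroup (V x)] [∀ x, Module ℝ (V x)] [∀ x, TopologicalSpace (V x)]
    [FiberBundle F V] [VectorBundle ℝ F V] (b : B) (f : F) : Π x, V x :=
  fun x => (trivializationAt F V b).symmL ℝ x f

theorem mdifferentiableAt_constSection [ContMDiffVectorBundle ∞ F V I] (b : B) (f : F) :
    MDifferentiableAt I (I.prod 𝓘(ℝ, F))
      (fun x => (⟨x, constSection V b f x⟩ : TotalSpace F V)) b := by
  have h : ContMDiffAt I (I.prod 𝓘(ℝ, F)) ∞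
      (fun x => (⟨x, constSection V b f x⟩ : TotalSpace F V)) b := by
    rw [Bundle.contMDiffAt_section]
    refine (contMDiffAt_const (c := f)).congr_of_eventuallyEq ?_
    filter_upwards [(trivializationAt F V b).open_baseSet.mem_nhds
      (FiberBundle.mem_baseSet_trivializationAt' b)] with x hx
    rw [constSection, Trivialization.symmL_apply _ hx, (trivializationAt F V b).apply_mk_symm hx]
  exact h.mdifferentiableAt (by simp)

section
variable [∀ x, IsTopologicalAddGroup (V x)] [∀ x, ContinuousSMul ℝ (V x)]

/-- The Christoffel symbols of a linear connection: `Γ(X) f = ∇_X s`, read in the preferred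
trivialization at `b`, where `s` is the section constant equal to `f` in that trivialization. -/
def christoffel [ContMDiffVectorBundle ∞ F V I] [FiniteDimensional ℝ F]
    (cov : CovariantDerivative I F V) (b : B) : LocalForm I F b where
  toFun X := LinearMap.toContinuousLinearMap
    { toFun := fun f =>
        (trivializationAt F V b).continuousLinearMapAt ℝ b (cov (constSection V b f) b X)
      map_add' := by
        intro f g
        have h : constSection V b (f + g) = constSection V b f + constSection V b g := by
          ext x; exact map_add _ f g
        rw [h, cov.isCovariantDerivativeOn.add (s := univ) (mdifferentiableAt_constSection b f)
          (mdifferentiableAt_constSection b g)]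
        exact map_add _ _ _
      map_smul' := by
        intro a f
        have h : constSection V b (a • f) = a • constSection V b f := by
          ext x; exact map_smul _ a f
        rw [h, cov.isCovariantDerivativeOn.smul_const (s := univ) a
          (mdifferentiableAt_constSection b f)]
        exact map_smul _ _ _ }
  map_add' X Y := by
    ext f
    simp
  map_smul' a X := by
    ext f
    simp
end

/-- The vertical projection `υ : T_w V → V_b` (`w ∈ V_b`) of the linear connection with local
connection forms `A`; in coordinates, `υ = (dη^k + Γ_i{}^k{}_j η^j du^i) ⊗ p_k`. -/
def verticalProj (A : Π b : B, LocalForm I F b) (w : TotalSpace F V) :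
    TangentSpace (I.prod 𝓘(ℝ, F)) w →ₗ[ℝ] V w.1 :=
  let dη : TangentSpace (I.prod 𝓘(ℝ, F)) w →L[ℝ] F :=
    mfderiv (I.prod 𝓘(ℝ, F)) 𝓘(ℝ, F) (fun w' => (trivializationAt F V w.1 w').2) w
  let dπ : TangentSpace (I.prod 𝓘(ℝ, F)) w →L[ℝ] TangentSpace I w.1 :=
    mfderiv (I.prod 𝓘(ℝ, F)) I (TotalSpace.proj : TotalSpace F V → B) w
  { toFun := fun ξ => (trivializationAt F V w.1).symmL ℝ w.1
      (dη ξ + A w.1 (dπ ξ) (trivializationAt F V w.1 w).2)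
    map_add' := by
      intro ξ ζ
      rw [← map_add]
      congr 1
      simp only [map_add, add_apply]
      abel
    map_smul' := by
      intro a ξ
      rw [RingHom.id_apply, ← map_smul]
      congr 1
      simp only [map_smul, smul_apply, smul_add] }

/-- The natural isomorphism of `V_b` with the vertical subspace of `T_w V`, `w ∈ V_b`: the
differential of the inclusion of the fibre `V_b`, identified with `F` by the preferred
trivialization at `b`. -/
def verticalLift (w : TotalSpace F V) : V w.1 →ₗ[ℝ] TangentSpace (I.prod 𝓘(ℝ, F)) w :=
  let dι : F →L[ℝ] TangentSpace (I.prod 𝓘(ℝ, F)) w :=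
    mfderiv 𝓘(ℝ, F) (I.prod 𝓘(ℝ, F))
      (fun f => (⟨w.1, (trivializationAt F V w.1).symmL ℝ w.1 f⟩ : TotalSpace F V))
      (trivializationAt F V w.1 w).2
  (dι : F →ₗ[ℝ] TangentSpace (I.prod 𝓘(ℝ, F)) w) ∘ₗ
    ((trivializationAt F V w.1).continuousLinearMapAt ℝ w.1 : V w.1 →ₗ[ℝ] F)

theorem mfderiv_proj_verticalLift [ContMDiffVectorBundle ∞ F V I] (w : TotalSpace F V)
    (z : V w.1) :
    mfderiv (I.prod 𝓘(ℝ, F)) I (TotalSpace.proj : TotalSpace F V → B) w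
      (verticalLift (I := I) w z) = 0 := by
  set e := trivializationAt F V w.1
  let g : F → TotalSpace F V := fun f => ⟨w.1, e.symmL ℝ w.1 f⟩
  have key : ∀ (f₀ f : F) (w' : TotalSpace F V), g f₀ = w' →
      (mfderiv (I.prod 𝓘(ℝ, F)) I (TotalSpace.proj : TotalSpace F V → B) w' : EB × F →L[ℝ] EB)
        ((mfderiv 𝓘(ℝ, F) (I.prod 𝓘(ℝ, F)) g f₀ : F →L[ℝ] EB × F) f) = 0 := by
    rintro f₀ f _ rfl
    by_cases hg : MDifferentiableAt 𝓘(ℝ, F) (I.prod 𝓘(ℝ, F)) g f₀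
    · have hp : MDifferentiableAt (I.prod 𝓘(ℝ, F)) I (TotalSpace.proj : TotalSpace F V → B)
          (g f₀) := (Bundle.contMDiffAt_proj V (n := ∞)).mdifferentiableAt (by simp)
      have hc := mfderiv_comp f₀ hp hg
      have hconst : (TotalSpace.proj ∘ g : F → B) = fun _ => w.1 := rfl
      rw [hconst, mfderiv_const] at hc
      exact (DFunLike.congr_fun hc f).symm
    · rw [mfderiv_zero_of_not_mdifferentiableAt hg]
      exact map_zero (mfderiv (I.prod 𝓘(ℝ, F)) I (TotalSpace.proj : TotalSpace F V → B) (g f₀))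
  refine key _ _ _ ?_
  have hb : w.1 ∈ e.baseSet := FiberBundle.mem_baseSet_trivializationAt' w.1
  have h2 : (e w).2 = e.continuousLinearMapAt ℝ w.1 w.2 := by
    exact (congrFun (e.coe_linearMapAt_of_mem (R := ℝ) hb) w.2).symm
  change (⟨w.1, e.symmL ℝ w.1 (e w).2⟩ : TotalSpace F V) = w
  rw [h2, e.symmL_continuousLinearMapAt hb]

/-- The vertical projection `υ : T V → ker Tπ ⊂ T V` of the linear connection on `π : V → B` with
local connection forms `A`. -/
def verticalEnd [ContMDiffVectorBundle ∞ F V I] (A : Π b : B, LocalForm I F b)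
    (w : TotalSpace F V) : TangentSpace (I.prod 𝓘(ℝ, F)) w →ₗ[ℝ]
      LinearMap.ker (mfderiv (I.prod 𝓘(ℝ, F)) I (TotalSpace.proj : TotalSpace F V → B) w :
        TangentSpace (I.prod 𝓘(ℝ, F)) w →ₗ[ℝ] TangentSpace I w.1) :=
  (verticalLift w ∘ₗ verticalProj A w).codRestrict _
    fun ξ => mfderiv_proj_verticalLift w (verticalProj A w ξ)

end Connections

/-! ### The connection on `J¹(E,n) → E` -/

section DotConnection

variable {n m : ℕ} {E : Type*} [TopologicalSpace E] [ChartedSpace (Rn (n + m)) E]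
  [IsManifold 𝓘(ℝ, Rn (n + m)) ∞ E]

/-- The fibre of the bundle `T^{1,0} = π_{1,0}^*(TE)`. -/
def TenFibre (θ : JetSub n m E) : Type :=
  PullFibre jetProj (TangentSpace 𝓘(ℝ, Rn (n + m)) : E → Type) θ

instance (θ : JetSub n m E) : AddCommGroup (TenFibre θ) :=
  instAddCommGroupPullFibre _ _ _
instance (θ : JetSub n m E) : Module ℝ (TenFibre θ) :=
  inferInstanceAs (Module ℝ
    (PullFibre jetProj (TangentSpace 𝓘(ℝ, Rn (n + m)) : E → Type) θ))
instance (θ : JetSub n m E) : TopologicalSpace (TenFibre θ) :=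
  inferInstanceAs (TopologicalSpace
    (PullFibre jetProj (TangentSpace 𝓘(ℝ, Rn (n + m)) : E → Type) θ))
instance (θ : JetSub n m E) : IsTopologicalAddGroup (TenFibre θ) :=
  inferInstanceAs (IsTopologicalAddGroup
    (PullFibre jetProj (TangentSpace 𝓘(ℝ, Rn (n + m)) : E → Type) θ))
instance (θ : JetSub n m E) : ContinuousSMul ℝ (TenFibre θ) :=
  inferInstanceAs (ContinuousSMul ℝ
    (PullFibre jetProj (TangentSpace 𝓘(ℝ, Rn (n + m)) : E → Type) θ))
instance : TopologicalSpace <| TotalSpace (Rn (n + m)) (TenFibre : JetSub n m E → Type) :=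
  inferInstanceAs (TopologicalSpace <| TotalSpace (Rn (n + m))
    (PullFibre jetProj (TangentSpace 𝓘(ℝ, Rn (n + m)) : E → Type) : JetSub n m E → Type))
instance : FiberBundle (Rn (n + m)) (TenFibre : JetSub n m E → Type) :=
  inferInstanceAs (FiberBundle (Rn (n + m))
    (PullFibre jetProj (TangentSpace 𝓘(ℝ, Rn (n + m)) : E → Type) : JetSub n m E → Type))
instance : VectorBundle ℝ (Rn (n + m)) (TenFibre : JetSub n m E → Type) :=
  inferInstanceAs (VectorBundle ℝ (Rn (n + m))
    (PullFibre jetProj (TangentSpace 𝓘(ℝ, Rn (n + m)) : E → Type) : JetSub n m E → Type))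
instance : ContMDiffVectorBundle ∞ (Rn (n + m)) (TenFibre : JetSub n m E → Type) 𝓘(ℝ, (Rn n × Rn m) × (Rn n →L[ℝ] Rn m)) :=
  inferInstanceAs (ContMDiffVectorBundle ∞ (Rn (n + m))
    (PullFibre jetProj (TangentSpace 𝓘(ℝ, Rn (n + m)) : E → Type) : JetSub n m E → Type) 𝓘(ℝ, (Rn n × Rn m) × (Rn n →L[ℝ] Rn m)))

/-- The fibre of the bundle `(H^{1,0})^* ⊗ T^{1,0}` over `J¹(E,n)`. -/
def JetHom (θ : JetSub n m E) : Type := HomFibre Horiz TenFibre θ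

instance (θ : JetSub n m E) : AddCommGroup (JetHom θ) :=
  instAddCommGroupHomFibre Horiz TenFibre θ
instance (θ : JetSub n m E) : Module ℝ (JetHom θ) :=
  inferInstanceAs (Module ℝ (HomFibre Horiz TenFibre θ))
instance (θ : JetSub n m E) : TopologicalSpace (JetHom θ) :=
  inferInstanceAs (TopologicalSpace (HomFibre Horiz TenFibre θ))
instance : TopologicalSpace (TotalSpace (Rn n →L[ℝ] Rn (n + m)) (JetHom : JetSub n m E → Type)) :=
  inferInstanceAs (TopologicalSpace (TotalSpace (Rn n →L[ℝ] Rn (n + m))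
    (HomFibre Horiz TenFibre : JetSub n m E → Type)))
instance : FiberBundle (Rn n →L[ℝ] Rn (n + m)) (JetHom : JetSub n m E → Type) :=
  inferInstanceAs (FiberBundle (Rn n →L[ℝ] Rn (n + m))
    (HomFibre Horiz TenFibre : JetSub n m E → Type))
instance : VectorBundle ℝ (Rn n →L[ℝ] Rn (n + m)) (JetHom : JetSub n m E → Type) :=
  inferInstanceAs (VectorBundle ℝ (Rn n →L[ℝ] Rn (n + m))
    (HomFibre Horiz TenFibre : JetSub n m E → Type))
instance : ContMDiffVectorBundle ∞ (Rn n →L[ℝ] Rn (n + m)) (JetHom : JetSub n m E → Type)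
    𝓘(ℝ, (Rn n × Rn m) × (Rn n →L[ℝ] Rn m)) :=
  inferInstanceAs (ContMDiffVectorBundle ∞ (Rn n →L[ℝ] Rn (n + m))
    (HomFibre Horiz TenFibre : JetSub n m E → Type) 𝓘(ℝ, (Rn n × Rn m) × (Rn n →L[ℝ] Rn m)))

/-- The inclusion `D¹ : H^{1,0} → T^{1,0}`, as a section of `(H^{1,0})^* ⊗ T^{1,0}`. -/
def D1 (θ : JetSub n m E) : TotalSpace (Rn n →L[ℝ] Rn (n + m)) (JetHom : JetSub n m E → Type) :=
  ⟨θ, Horiz.incl θ⟩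

/-- The map `id ⊗ ω¹ : (H^{1,0})^* ⊗ T^{1,0} → (H^{1,0})^* ⊗ V^{1,0}`, `V^{1,0} = T^{1,0} / H^{1,0}`,
over a point of `J¹(E,n)`. -/
def idTensorOmega (θ : JetSub n m E) : JetHom θ →ₗ[ℝ]
    (Horiz θ →ₗ[ℝ] TangentSpace 𝓘(ℝ, Rn (n + m)) θ.pt ⧸ θ.plane) where
  toFun Φ := θ.plane.mkQ ∘ₗ
    ((show Horiz θ →L[ℝ] TangentSpace 𝓘(ℝ, Rn (n + m)) θ.pt from Φ) : Horiz θ →ₗ[ℝ] _)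
  map_add' Φ Ψ := by ext y; exact map_add θ.plane.mkQ _ _
  map_smul' a Φ := by ext y; exact map_smul θ.plane.mkQ a _

/-- The tangent map `T_θ D¹` at a point `θ` of `J¹(E,n)`. -/
def tangentD1 (θ : JetSub n m E) :
    TangentSpace 𝓘(ℝ, (Rn n × Rn m) × (Rn n →L[ℝ] Rn m)) θ →ₗ[ℝ]
      TangentSpace (𝓘(ℝ, (Rn n × Rn m) × (Rn n →L[ℝ] Rn m)).prod 𝓘(ℝ, Rn n →L[ℝ] Rn (n + m)))
        (D1 θ) :=
  (mfderiv 𝓘(ℝ, (Rn n × Rn m) × (Rn n →L[ℝ] Rn m))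
    (𝓘(ℝ, (Rn n × Rn m) × (Rn n →L[ℝ] Rn m)).prod 𝓘(ℝ, Rn n →L[ℝ] Rn (n + m))) D1 θ).toLinearMap

/-- The map `v ↦ d/dt D¹(γ(t))` at `t = 0` modulo `H^{1,0}`, where `γ` is a curve with velocity `v`,
and the derivative is taken in the preferred local trivialization at `θ`. -/
def derivD1 (θ : JetSub n m E) : TangentSpace 𝓘(ℝ, (Rn n × Rn m) × (Rn n →L[ℝ] Rn m)) θ →ₗ[ℝ]
    (Horiz θ →ₗ[ℝ] TangentSpace 𝓘(ℝ, Rn (n + m)) θ.pt ⧸ θ.plane) :=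
  idTensorOmega θ ∘ₗ verticalProj (fun _ => 0) (D1 θ) ∘ₗ tangentD1 θ

/-- The vertical subspace `ker T_θ π_{1,0}`. -/
abbrev jetVertical (θ : JetSub n m E) :
    Submodule ℝ (TangentSpace 𝓘(ℝ, (Rn n × Rn m) × (Rn n →L[ℝ] Rn m)) θ) :=
  LinearMap.ker (mfderiv 𝓘(ℝ, (Rn n × Rn m) × (Rn n →L[ℝ] Rn m)) 𝓘(ℝ, Rn (n + m))
    (JetSub.pt : JetSub n m E → E) θ).toLinearMap

theorem hasMFDerivAt_jetChart (θ : JetSub n m E) :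
    HasMFDerivAt 𝓘(ℝ, (Rn n × Rn m) × (Rn n →L[ℝ] Rn m))
      𝓘(ℝ, (Rn n × Rn m) × (Rn n →L[ℝ] Rn m)) (preferredChart θ).jetHomeo θ
      (ContinuousLinearMap.id ℝ ((Rn n × Rn m) × (Rn n →L[ℝ] Rn m))) := by
  have h1 : MDifferentiableAt 𝓘(ℝ, (Rn n × Rn m) × (Rn n →L[ℝ] Rn m))
      𝓘(ℝ, (Rn n × Rn m) × (Rn n →L[ℝ] Rn m)) (preferredChart θ).jetHomeo θ :=
    ((preferredChart θ).contMDiffOn_jetHomeo.contMDiffAt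
      ((preferredChart θ).jetHomeo.open_source.mem_nhds
        (mem_preferredChart_domain θ))).mdifferentiableAt (by simp)
  have h2 := mfderiv_extChartAt_self (I := 𝓘(ℝ, (Rn n × Rn m) × (Rn n →L[ℝ] Rn m))) (x := θ)
  have h3 := h1.hasMFDerivAt
  have h4 : mfderiv 𝓘(ℝ, (Rn n × Rn m) × (Rn n →L[ℝ] Rn m))
      𝓘(ℝ, (Rn n × Rn m) × (Rn n →L[ℝ] Rn m)) (preferredChart θ).jetHomeo θ =
      ContinuousLinearMap.id ℝ ((Rn n × Rn m) × (Rn n →L[ℝ] Rn m)) := h2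
  rw [h4] at h3
  exact h3

theorem DividedChart.hasMFDerivAt_coord (c : DividedChart n m E) {p : E}
    (hp : p ∈ c.chart.source) :
    HasMFDerivAt 𝓘(ℝ, Rn (n + m)) 𝓘(ℝ, Rn n × Rn m) c.coord p (c.diff p) := by
  have h := mdifferentiable_of_mem_atlas (I := 𝓘(ℝ, Rn (n + m))) c.mem
  exact (c.split.hasFDerivAt.hasMFDerivAt).comp p (h.mdifferentiableAt hp).hasMFDerivAt

theorem diff_mfderiv_pt (θ : JetSub n m E)
    (v : TangentSpace 𝓘(ℝ, (Rn n × Rn m) × (Rn n →L[ℝ] Rn m)) θ) :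
    (preferredChart θ).diff θ.pt (mfderiv 𝓘(ℝ, (Rn n × Rn m) × (Rn n →L[ℝ] Rn m))
      𝓘(ℝ, Rn (n + m)) (JetSub.pt : JetSub n m E → E) θ v) =
      (show (Rn n × Rn m) × (Rn n →L[ℝ] Rn m) from v).1 := by
  have h1 := ((preferredChart θ).hasMFDerivAt_coord (mem_preferredChart_domain θ).1).comp θ
    ((contMDiff_pt (n := n) (m := m) (E := E)).mdifferentiable (by simp) θ).hasMFDerivAt
  have h2 := ((ContinuousLinearMap.fst ℝ (Rn n × Rn m)
    (Rn n →L[ℝ] Rn m)).hasFDerivAt.hasMFDerivAt).comp θ (hasMFDerivAt_jetChart θ)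
  exact DFunLike.congr_fun (hasMFDerivAt_unique h1 h2) v

theorem horizTriv_symm_coord (θ : JetSub n m E) {θ' : JetSub n m E}
    (h : θ' ∈ (preferredChart θ).domain) (z : Rn n) :
    (preferredChart θ).horizCoord θ'
      ((trivializationAt (Rn n) (Horiz : JetSub n m E → Type) θ).symmL ℝ θ' z) = z := by
  have hb : θ' ∈ (trivializationAt (Rn n) (Horiz : JetSub n m E → Type) θ).baseSet := h
  have h1 := (trivializationAt (Rn n) (Horiz : JetSub n m E → Type) θ).apply_mk_symm hb z
  rw [Trivialization.symmL_apply _ hb]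
  exact congrArg Prod.snd h1

theorem trivialization_D1 (θ : JetSub n m E) {θ' : JetSub n m E}
    (h : θ' ∈ (preferredChart θ).domain) :
    (trivializationAt (Rn n →L[ℝ] Rn (n + m)) (JetHom : JetSub n m E → Type) θ (D1 θ')).2 =
      ((preferredChart θ).split.symm : Rn n × Rn m →L[ℝ] Rn (n + m)).comp
        ((ContinuousLinearMap.id ℝ (Rn n)).prod ((preferredChart θ).jetSlope θ')) := by
  ext1 z
  have hsrc : θ'.pt ∈ (chartAt (Rn (n + m)) θ.pt).source := by
    rw [← preferredChart_chart]; exact h.1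
  set y := (trivializationAt (Rn n) (Horiz : JetSub n m E → Type) θ).symmL ℝ θ' z with hy
  have h1 := (preferredChart θ).diff_incl h y
  rw [hy, horizTriv_symm_coord θ h, ← hy] at h1
  have h2 : (trivializationAt (Rn n →L[ℝ] Rn (n + m)) (JetHom : JetSub n m E → Type) θ
      (D1 θ')).2 z = (trivializationAt (Rn (n + m))
        (TangentSpace 𝓘(ℝ, Rn (n + m)) : E → Type) θ.pt).continuousLinearMapAt ℝ θ'.pt
          (Horiz.incl θ' y) := rfl
  rw [h2, TangentBundle.continuousLinearMapAt_trivializationAt hsrc]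
  change _ = (preferredChart θ).split.symm (z, (preferredChart θ).jetSlope θ' z)
  rw [← h1]
  change _ = (preferredChart θ).split.symm ((preferredChart θ).split _)
  rw [ContinuousLinearEquiv.symm_apply_apply, preferredChart_chart]
  rfl

/-- The linear map `A ↦ (x ↦ (0, A x))` read in a divided chart. -/
def DividedChart.slopeHom (c : DividedChart n m E) :
    (Rn n × Rn m) × (Rn n →L[ℝ] Rn m) →L[ℝ] (Rn n →L[ℝ] Rn (n + m)) :=
  (ContinuousLinearMap.compL ℝ (Rn n) (Rn m) (Rn (n + m))
    ((c.split.symm : Rn n × Rn m →L[ℝ] Rn (n + m)).comp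
      (ContinuousLinearMap.inr ℝ (Rn n) (Rn m)))).comp
    (ContinuousLinearMap.snd ℝ (Rn n × Rn m) (Rn n →L[ℝ] Rn m))

theorem hasMFDerivAt_trivialization_D1 (θ : JetSub n m E) :
    HasMFDerivAt 𝓘(ℝ, (Rn n × Rn m) × (Rn n →L[ℝ] Rn m)) 𝓘(ℝ, Rn n →L[ℝ] Rn (n + m))
      (fun θ' => (trivializationAt (Rn n →L[ℝ] Rn (n + m)) (JetHom : JetSub n m E → Type) θ
        (D1 θ')).2) θ (preferredChart θ).slopeHom := by
  have h1 : HasFDerivAt (fun z : (Rn n × Rn m) × (Rn n →L[ℝ] Rn m) =>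
      ((preferredChart θ).split.symm : Rn n × Rn m →L[ℝ] Rn (n + m)).comp
        (ContinuousLinearMap.inl ℝ (Rn n) (Rn m)) + (preferredChart θ).slopeHom z)
      (preferredChart θ).slopeHom
      ((preferredChart θ).jetHomeo θ) := (preferredChart θ).slopeHom.hasFDerivAt.const_add _
  have h2 := h1.hasMFDerivAt.comp θ (hasMFDerivAt_jetChart θ)
  refine HasMFDerivAt.congr_of_eventuallyEq h2 ?_
  filter_upwards [(preferredChart θ).jetHomeo.open_source.mem_nhds
    (mem_preferredChart_domain θ)] with θ' hθ'
  rw [trivialization_D1 θ hθ']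
  ext1 z
  change (preferredChart θ).split.symm (z, (preferredChart θ).jetSlope θ' z) =
    (preferredChart θ).split.symm (z, 0) +
      (preferredChart θ).split.symm (0, (preferredChart θ).jetSlope θ' z)
  rw [← map_add, Prod.mk_add_mk, add_zero, zero_add]

theorem mdifferentiableAt_D1 (θ : JetSub n m E) :
    MDifferentiableAt 𝓘(ℝ, (Rn n × Rn m) × (Rn n →L[ℝ] Rn m))
      (𝓘(ℝ, (Rn n × Rn m) × (Rn n →L[ℝ] Rn m)).prod 𝓘(ℝ, Rn n →L[ℝ] Rn (n + m)))
      (D1 : JetSub n m E → _) θ :=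
  (mdifferentiableAt_totalSpace _ _).2 ⟨mdifferentiableAt_id,
    (hasMFDerivAt_trivialization_D1 θ).mdifferentiableAt⟩

theorem mfderiv_trivialization_tangentD1 (θ : JetSub n m E)
    (v : TangentSpace 𝓘(ℝ, (Rn n × Rn m) × (Rn n →L[ℝ] Rn m)) θ) :
    (mfderiv (𝓘(ℝ, (Rn n × Rn m) × (Rn n →L[ℝ] Rn m)).prod 𝓘(ℝ, Rn n →L[ℝ] Rn (n + m)))
      𝓘(ℝ, Rn n →L[ℝ] Rn (n + m)) (fun w' => (trivializationAt (Rn n →L[ℝ] Rn (n + m))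
        (JetHom : JetSub n m E → Type) θ w').2) (D1 θ) (tangentD1 θ v) :
          Rn n →L[ℝ] Rn (n + m)) =
      ((preferredChart θ).split.symm : Rn n × Rn m →L[ℝ] Rn (n + m)).comp
          ((ContinuousLinearMap.inr ℝ (Rn n) (Rn m)).comp
            (show (Rn n × Rn m) × (Rn n →L[ℝ] Rn m) from v).2) := by
  have hη : MDifferentiableAt (𝓘(ℝ, (Rn n × Rn m) × (Rn n →L[ℝ] Rn m)).prod
      𝓘(ℝ, Rn n →L[ℝ] Rn (n + m))) 𝓘(ℝ, Rn n →L[ℝ] Rn (n + m))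
      (fun w' => (trivializationAt (Rn n →L[ℝ] Rn (n + m))
        (JetHom : JetSub n m E → Type) θ w').2) (D1 θ) :=
    ((mdifferentiableAt_totalSpace 𝓘(ℝ, (Rn n × Rn m) × (Rn n →L[ℝ] Rn m))
      (id : TotalSpace (Rn n →L[ℝ] Rn (n + m)) (JetHom : JetSub n m E → Type) → _)
        (x₀ := D1 θ)).1 mdifferentiableAt_id).2
  have h1 := hη.hasMFDerivAt.comp θ (mdifferentiableAt_D1 θ).hasMFDerivAt
  exact DFunLike.congr_fun (hasMFDerivAt_unique h1 (hasMFDerivAt_trivialization_D1 θ)) v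

theorem trivializationAt_jetHom_symmL (θ : JetSub n m E) (Φ : Rn n →L[ℝ] Rn (n + m))
    (y : Horiz θ) :
    (show Horiz θ →L[ℝ] TangentSpace 𝓘(ℝ, Rn (n + m)) θ.pt from
      (trivializationAt (Rn n →L[ℝ] Rn (n + m)) (JetHom : JetSub n m E → Type) θ).symmL ℝ θ Φ) y =
      (trivializationAt (Rn (n + m)) (TangentSpace 𝓘(ℝ, Rn (n + m)) : E → Type) θ.pt).symmL ℝ θ.pt
        (Φ ((preferredChart θ).horizCoord θ y)) := by
  have hb1 : θ ∈ (trivializationAt (Rn n) (Horiz : JetSub n m E → Type) θ).baseSet :=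
    mem_preferredChart_domain θ
  have hb : θ ∈ (trivializationAt (Rn n →L[ℝ] Rn (n + m))
      (JetHom : JetSub n m E → Type) θ).baseSet := FiberBundle.mem_baseSet_trivializationAt' θ
  have h1 := Pretrivialization.continuousLinearMap_symm_apply' (RingHom.id ℝ)
    (trivializationAt (Rn n) (Horiz : JetSub n m E → Type) θ)
    (trivializationAt (Rn (n + m)) (TenFibre : JetSub n m E → Type) θ)
    (b := θ) hb Φ
  have h2 : (trivializationAt (Rn n) (Horiz : JetSub n m E → Type) θ).continuousLinearMapAt ℝ θ y =
      (preferredChart θ).horizCoord θ y :=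
    congrFun ((trivializationAt (Rn n) (Horiz : JetSub n m E → Type) θ).coe_linearMapAt_of_mem
      (R := ℝ) hb1) y
  rw [Trivialization.symmL_apply _ hb, ← h2]
  exact (DFunLike.congr_fun h1 y).trans (PullFibre.symmL_trivializationAt jetProj (Rn (n + m))
    (TangentSpace 𝓘(ℝ, Rn (n + m)) : E → Type) θ _)

/-- In coordinates, the map `derivD1` is `u̇^i_λ ↦ u̇^i_λ du^λ ⊗ ∂_{u^i}`. -/
theorem derivD1_coord (θ : JetSub n m E)
    (v : TangentSpace 𝓘(ℝ, (Rn n × Rn m) × (Rn n →L[ℝ] Rn m)) θ) (y : Horiz θ) :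
    derivD1 θ v y = θ.plane.mkQ ((trivializationAt (Rn (n + m))
      (TangentSpace 𝓘(ℝ, Rn (n + m)) : E → Type) θ.pt).symmL ℝ θ.pt
        ((preferredChart θ).split.symm (0, (show (Rn n × Rn m) × (Rn n →L[ℝ] Rn m) from v).2
          ((preferredChart θ).horizCoord θ y)))) := by
  have h1 := mfderiv_trivialization_tangentD1 θ v
  have h2 := trivializationAt_jetHom_symmL θ
    (((preferredChart θ).split.symm : Rn n × Rn m →L[ℝ] Rn (n + m)).comp
          ((ContinuousLinearMap.inr ℝ (Rn n) (Rn m)).comp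
            (show (Rn n × Rn m) × (Rn n →L[ℝ] Rn m) from v).2)) y
  rw [← h1] at h2
  have h3 : verticalProj (fun _ => 0) (D1 θ) (tangentD1 θ v) =
      (trivializationAt (Rn n →L[ℝ] Rn (n + m)) (JetHom : JetSub n m E → Type) θ).symmL ℝ θ
      (mfderiv (𝓘(ℝ, (Rn n × Rn m) × (Rn n →L[ℝ] Rn m)).prod 𝓘(ℝ, Rn n →L[ℝ] Rn (n + m)))
      𝓘(ℝ, Rn n →L[ℝ] Rn (n + m)) (fun w' => (trivializationAt (Rn n →L[ℝ] Rn (n + m))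
        (JetHom : JetSub n m E → Type) θ w').2) (D1 θ) (tangentD1 θ v) :
          Rn n →L[ℝ] Rn (n + m)) := by
    refine congrArg ((trivializationAt (Rn n →L[ℝ] Rn (n + m))
      (JetHom : JetSub n m E → Type) θ).symmL ℝ θ) (add_zero _)
  refine (congrArg θ.plane.mkQ (Eq.trans ?_ h2)).trans ?_
  · exact congrArg (fun Ψ : JetHom θ => (show Horiz θ →L[ℝ]
      TangentSpace 𝓘(ℝ, Rn (n + m)) θ.pt from Ψ) y) h3
  · rw [h1]; rfl

theorem tangentTriv_symmL_self (p : E) (z : Rn (n + m)) :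
    mfderiv 𝓘(ℝ, Rn (n + m)) 𝓘(ℝ, Rn (n + m)) (chartAt (Rn (n + m)) p) p
      ((trivializationAt (Rn (n + m)) (TangentSpace 𝓘(ℝ, Rn (n + m)) : E → Type) p).symmL ℝ p z) =
      z := by
  have h := TangentBundle.continuousLinearMapAt_trivializationAt (I := 𝓘(ℝ, Rn (n + m)))
    (x₀ := p) (x := p) (mem_chart_source _ p)
  have h2 := (trivializationAt (Rn (n + m)) (TangentSpace 𝓘(ℝ, Rn (n + m)) : E → Type)
    p).continuousLinearMapAt_symmL (R := ℝ) (FiberBundle.mem_baseSet_trivializationAt' p) z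
  rw [h] at h2
  exact h2

/-- The components `du^i` of a vector modulo the plane `θ`. -/
def normalCoord (θ : JetSub n m E) :
    (TangentSpace 𝓘(ℝ, Rn (n + m)) θ.pt ⧸ θ.plane) →ₗ[ℝ] Rn m :=
  θ.plane.liftQ ((LinearMap.snd ℝ (Rn n) (Rn m)) ∘ₗ
    ((preferredChart θ).diff θ.pt :
      TangentSpace 𝓘(ℝ, Rn (n + m)) θ.pt →ₗ[ℝ] Rn n × Rn m)) (by
      intro x hx
      have h : (preferredChart θ).diff θ.pt x ∈ (0 : Rn n →ₗ[ℝ] Rn m).graph := by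
        rw [← map_preferredChart θ]; exact Submodule.mem_map_of_mem hx
      exact h)

theorem normalCoord_injective (θ : JetSub n m E) : Function.Injective (normalCoord θ) := by
  rw [← LinearMap.ker_eq_bot, eq_bot_iff]
  intro q hq
  obtain ⟨x, rfl⟩ := θ.plane.mkQ_surjective q
  have h : (preferredChart θ).diff θ.pt x ∈ (0 : Rn n →ₗ[ℝ] Rn m).graph := hq
  rw [← map_preferredChart θ] at h
  obtain ⟨x', hx', h⟩ := h
  have : x' = x := ((preferredChart θ).diff_bijective (mem_preferredChart_domain θ).1).1 h
  rw [Submodule.mem_bot, Submodule.mkQ_apply, Submodule.Quotient.mk_eq_zero]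
  exact this ▸ hx'

theorem normalCoord_derivD1 (θ : JetSub n m E)
    (v : TangentSpace 𝓘(ℝ, (Rn n × Rn m) × (Rn n →L[ℝ] Rn m)) θ) (y : Horiz θ) :
    normalCoord θ (derivD1 θ v y) = (show (Rn n × Rn m) × (Rn n →L[ℝ] Rn m) from v).2
      ((preferredChart θ).horizCoord θ y) := by
  rw [derivD1_coord]
  set z : Rn (n + m) := (preferredChart θ).split.symm
    (0, (show (Rn n × Rn m) × (Rn n →L[ℝ] Rn m) from v).2 ((preferredChart θ).horizCoord θ y))
    with hz
  have h1 := tangentTriv_symmL_self θ.pt z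
  rw [← preferredChart_chart] at h1
  have h2 := congrArg (fun z => ((preferredChart θ).split z).2) h1
  refine Eq.trans h2 ?_
  simp [hz]

theorem mem_jetVertical_iff (θ : JetSub n m E)
    (v : TangentSpace 𝓘(ℝ, (Rn n × Rn m) × (Rn n →L[ℝ] Rn m)) θ) :
    v ∈ jetVertical θ ↔ (show (Rn n × Rn m) × (Rn n →L[ℝ] Rn m) from v).1 = 0 := by
  have hi := ((preferredChart θ).diff_bijective (mem_preferredChart_domain θ).1).1
  rw [← diff_mfderiv_pt, LinearMap.mem_ker]
  constructor
  · intro h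
    exact (congrArg _ h).trans (map_zero _)
  · intro h
    exact hi (h.trans (map_zero _).symm)

theorem derivD1_bijective (θ : JetSub n m E) :
    Function.Bijective (derivD1 θ ∘ₗ (jetVertical θ).subtype) := by
  have hH := (preferredChart θ).horizCoord_bijective (mem_preferredChart_domain θ)
  constructor
  · rw [← LinearMap.ker_eq_bot, eq_bot_iff]
    rintro ⟨v, hv⟩ hv0
    have hv1 := (mem_jetVertical_iff θ v).1 hv
    have hv2 : (show (Rn n × Rn m) × (Rn n →L[ℝ] Rn m) from v).2 = 0 := by
      ext1 z
      obtain ⟨y, rfl⟩ := hH.2 z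
      rw [← normalCoord_derivD1]
      have : derivD1 θ v = 0 := hv0
      rw [this]
      simp
    rw [Submodule.mem_bot]
    exact Subtype.ext (Prod.ext hv1 hv2)
  · intro Ψ
    let B : Rn n →L[ℝ] Rn m := LinearMap.toContinuousLinearMap (normalCoord θ ∘ₗ Ψ ∘ₗ
      ((preferredChart θ).horizEquiv (mem_preferredChart_domain θ)).symm.toLinearMap)
    let v : TangentSpace 𝓘(ℝ, (Rn n × Rn m) × (Rn n →L[ℝ] Rn m)) θ :=
      ((0, B) : (Rn n × Rn m) × (Rn n →L[ℝ] Rn m))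
    refine ⟨⟨v, (mem_jetVertical_iff θ v).2 rfl⟩, ?_⟩
    ext1 y
    apply normalCoord_injective
    refine (normalCoord_derivD1 θ v y).trans ?_
    change normalCoord θ (Ψ (((preferredChart θ).horizEquiv (mem_preferredChart_domain θ)).symm
      (((preferredChart θ).horizEquiv (mem_preferredChart_domain θ)) y))) = _
    rw [LinearEquiv.symm_apply_apply]

/-- The isomorphism `ker Tπ_{1,0} ≃ (H^{1,0})^* ⊗ V^{1,0}` over a point of `J¹(E,n)`. -/
def jetVerticalEquiv (θ : JetSub n m E) : jetVertical θ ≃ₗ[ℝ]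
    (Horiz θ →ₗ[ℝ] TangentSpace 𝓘(ℝ, Rn (n + m)) θ.pt ⧸ θ.plane) :=
  LinearEquiv.ofBijective _ (derivD1_bijective θ)

/-- The vertical projection `υ : TJ¹(E,n) → ker Tπ_{1,0} ≃ (H^{1,0})^* ⊗ V^{1,0}` of the connection
on `π_{1,0}` associated with a linear connection `Γ` on `TE`: the composition of `TD¹`, of the
vertical projection of the linear connection `Ξ^* ⊗ π_{1,0}^*(Γ)` on `(H^{1,0})^* ⊗ T^{1,0}`, and
of `id ⊗ ω¹`. Here `Ξ^*` is the dual of an auxiliary linear connection `Ξ` on `H^{1,0}`. -/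
def upsilonDot (Γ : CovariantDerivative 𝓘(ℝ, Rn (n + m)) (Rn (n + m))
      (TangentSpace 𝓘(ℝ, Rn (n + m)) : E → Type))
    (Ξ : CovariantDerivative 𝓘(ℝ, (Rn n × Rn m) × (Rn n →L[ℝ] Rn m)) (Rn n)
      (Horiz : JetSub n m E → Type)) (θ : JetSub n m E) :
    TangentSpace 𝓘(ℝ, (Rn n × Rn m) × (Rn n →L[ℝ] Rn m)) θ →ₗ[ℝ] jetVertical θ :=
  (jetVerticalEquiv θ).symm.toLinearMap ∘ₗ idTensorOmega θ ∘ₗ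
    verticalProj (homForm (christoffel Ξ) (pullbackForm jetProj (christoffel Γ))) (D1 θ) ∘ₗ
      tangentD1 θ

end DotConnection

/-! ### First jets of parametrized submanifolds -/

section Parametrized

variable (n m : ℕ) (M E : Type*) [TopologicalSpace M] [ChartedSpace (Rn n) M]
  [IsManifold 𝓘(ℝ, Rn n) ∞ M]
  [TopologicalSpace E] [ChartedSpace (Rn (n + m)) E] [IsManifold 𝓘(ℝ, Rn (n + m)) ∞ E]

/-- The projection `pr_M : M × E → M`. -/
def prM : C^∞⟮𝓘(ℝ, Rn n).prod 𝓘(ℝ, Rn (n + m)), M × E; 𝓘(ℝ, Rn n), M⟯ := ContMDiffMap.fst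

/-- The projection `pr_E : M × E → E`. -/
def prE : C^∞⟮𝓘(ℝ, Rn n).prod 𝓘(ℝ, Rn (n + m)), M × E; 𝓘(ℝ, Rn (n + m)), E⟯ :=
  ContMDiffMap.snd

/-- The fibre `Hom(T_x M, T_p E)` over `(x, p)` of the bundle
`J¹pr_M = pr_E^*(TE) ⊗ pr_M^*(T^*M) → M × E`; the jet `[s]¹_x` of a map `s : M → E`, regarded as a
section of `pr_M`, is identified with the linear map `T_x s`. -/
def ParJetFibre (z : M × E) : Type :=
  HomFibre (PullFibre (prM n m M E) (TangentSpace 𝓘(ℝ, Rn n) : M → Type))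
    (PullFibre (prE n m M E) (TangentSpace 𝓘(ℝ, Rn (n + m)) : E → Type)) z

instance (z : M × E) : AddCommGroup (ParJetFibre n m M E z) :=
  instAddCommGroupHomFibre (PullFibre (prM n m M E) (TangentSpace 𝓘(ℝ, Rn n) : M → Type))
    (PullFibre (prE n m M E) (TangentSpace 𝓘(ℝ, Rn (n + m)) : E → Type)) z
instance (z : M × E) : Module ℝ (ParJetFibre n m M E z) :=
  inferInstanceAs (Module ℝ (HomFibre
    (PullFibre (prM n m M E) (TangentSpace 𝓘(ℝ, Rn n) : M → Type))
    (PullFibre (prE n m M E) (TangentSpace 𝓘(ℝ, Rn (n + m)) : E → Type)) z))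
instance (z : M × E) : TopologicalSpace (ParJetFibre n m M E z) :=
  inferInstanceAs (TopologicalSpace (HomFibre
    (PullFibre (prM n m M E) (TangentSpace 𝓘(ℝ, Rn n) : M → Type))
    (PullFibre (prE n m M E) (TangentSpace 𝓘(ℝ, Rn (n + m)) : E → Type)) z))
instance : TopologicalSpace <| TotalSpace (Rn n →L[ℝ] Rn (n + m)) (ParJetFibre n m M E) :=
  inferInstanceAs (TopologicalSpace <| TotalSpace (Rn n →L[ℝ] Rn (n + m)) (HomFibre
    (PullFibre (prM n m M E) (TangentSpace 𝓘(ℝ, Rn n) : M → Type))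
    (PullFibre (prE n m M E) (TangentSpace 𝓘(ℝ, Rn (n + m)) : E → Type))))
instance : FiberBundle (Rn n →L[ℝ] Rn (n + m)) (ParJetFibre n m M E) :=
  inferInstanceAs (FiberBundle (Rn n →L[ℝ] Rn (n + m)) (HomFibre
    (PullFibre (prM n m M E) (TangentSpace 𝓘(ℝ, Rn n) : M → Type))
    (PullFibre (prE n m M E) (TangentSpace 𝓘(ℝ, Rn (n + m)) : E → Type))))
instance : VectorBundle ℝ (Rn n →L[ℝ] Rn (n + m)) (ParJetFibre n m M E) :=
  inferInstanceAs (VectorBundle ℝ (Rn n →L[ℝ] Rn (n + m)) (HomFibre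
    (PullFibre (prM n m M E) (TangentSpace 𝓘(ℝ, Rn n) : M → Type))
    (PullFibre (prE n m M E) (TangentSpace 𝓘(ℝ, Rn (n + m)) : E → Type))))
instance : ContMDiffVectorBundle ∞ (Rn n →L[ℝ] Rn (n + m)) (ParJetFibre n m M E) (𝓘(ℝ, Rn n).prod 𝓘(ℝ, Rn (n + m))) :=
  inferInstanceAs (ContMDiffVectorBundle ∞ (Rn n →L[ℝ] Rn (n + m)) (HomFibre
    (PullFibre (prM n m M E) (TangentSpace 𝓘(ℝ, Rn n) : M → Type))
    (PullFibre (prE n m M E) (TangentSpace 𝓘(ℝ, Rn (n + m)) : E → Type))) (𝓘(ℝ, Rn n).prod 𝓘(ℝ, Rn (n + m))))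

/-- The manifold `J¹pr_M`. -/
abbrev ParJet : Type _ := TotalSpace (Rn n →L[ℝ] Rn (n + m)) (ParJetFibre n m M E)

/-- The model with corners of `J¹pr_M`. -/
abbrev ParJetModel (n m : ℕ) :=
  (𝓘(ℝ, Rn n).prod 𝓘(ℝ, Rn (n + m))).prod 𝓘(ℝ, Rn n →L[ℝ] Rn (n + m))

variable {n m M E}

/-- The linear map `T_x s : T_x M → T_p E` of a jet `[s]¹_x`. -/
def ParJet.tangentMap (Φ : ParJet n m M E) :
    TangentSpace 𝓘(ℝ, Rn n) Φ.1.1 →L[ℝ] TangentSpace 𝓘(ℝ, Rn (n + m)) Φ.1.2 := Φ.2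

variable (n m M E) in
/-- The set `Imm J¹pr_M` of the jets of immersions. -/
def immJet : Set (ParJet n m M E) := {Φ | Function.Injective (ParJet.tangentMap Φ)}

/-- The prolongation `pr_E^(1) : Imm J¹pr_M → J¹(E,n)`, `[s]¹_x ↦ [im s]¹_{s(x)}`: the tangent plane
to the image of an immersion `s` is the image of `T_x s`. (Its values outside `Imm J¹pr_M` are
irrelevant.) -/
def prolongE (Φ : ParJet n m M E) : JetSub n m E :=
  JetSub.ofSubmodule Φ.1.2 (LinearMap.range (ParJet.tangentMap Φ).toLinearMap)

/-- The vertical projection `υ : TJ¹pr_M → ker T(pr_M)_{1,0}` of the connection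
`pr_E^*(Γ) ⊗ pr_M^*(Θ^*)`. -/
def upsilonDotPar (Γ : CovariantDerivative 𝓘(ℝ, Rn (n + m)) (Rn (n + m))
      (TangentSpace 𝓘(ℝ, Rn (n + m)) : E → Type))
    (Θ : CovariantDerivative 𝓘(ℝ, Rn n) (Rn n) (TangentSpace 𝓘(ℝ, Rn n) : M → Type))
    (Φ : ParJet n m M E) : TangentSpace (ParJetModel n m) Φ →ₗ[ℝ]
      LinearMap.ker (mfderiv (ParJetModel n m) (𝓘(ℝ, Rn n).prod 𝓘(ℝ, Rn (n + m)))
        (TotalSpace.proj : ParJet n m M E → M × E) Φ).toLinearMap :=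
  verticalEnd (homForm (pullbackForm (prM n m M E) (christoffel Θ))
    (pullbackForm (prE n m M E) (christoffel Γ))) Φ

end Parametrized

end

noncomputable section

/-! ### Bundles in the preferred trivialization -/

section Vertical

variable {EB : Type*} [NormedAddCommGroup EB] [NormedSpace ℝ EB]
  {HB : Type*} [TopologicalSpace HB] {I : ModelWithCorners ℝ EB HB}
  {B : Type*} [TopologicalSpace B] [ChartedSpace HB B]
  {F : Type*} [NormedAddCommGroup F] [NormedSpace ℝ F]
  {V : B → Type*} [TopologicalSpace (TotalSpace F V)]
  [∀ x, AddCommGroup (V x)] [∀ x, Module ℝ (V x)] [∀ x, TopologicalSpace (V x)]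
  [FiberBundle F V] [VectorBundle ℝ F V]

/-! Both sides are computed in one well-chosen chart. Fix a jet `Φ` with image plane `θ`, and use on
`E` the preferred chart at the base point, split so that `θ` becomes ℝⁿ × 0. The linear map `Φ` then
has fibre coordinates `A` with an invertible first block P and a vanishing second block Q
(`preferredChart_parCoord`). For nearby jets the image of (P, Q) is the graph of Q P⁻¹, so in charts
the prolongation is (x, p, A) ↦ (u(p), Q P⁻¹) (`jetHomeo_prolongE`). This is smooth because
inversion is smooth at P. Since Q = 0 at `Φ`, the derivative of P⁻¹ does not contribute, and the
differential at `Φ` is (ẋ, ṗ, Ȧ) ↦ (du(ṗ), Q̇ P⁻¹) (`mfderiv_prolongE`).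

On parametrized jets the vertical projection kills the base velocity and replaces Ȧ by Ȧ + Γ(ṗ) A −
A Θ(ẋ). Taking the second block and composing with P⁻¹ removes the Θ term, because A has values in
the plane. What remains is Q̇ P⁻¹ plus the second block of Γ(ṗ) A P⁻¹, and A P⁻¹ is the inclusion of
ℝⁿ × 0 (`DividedChart.comp_inverse_parFst`).

On `J¹(E,n)` the section `D1` has the coordinates (id, slope), hence is that same inclusion at `θ`.
Modulo the plane its covariant derivative is the velocity of the slope plus the second block of Γ(ṗ)
applied to the inclusion. The term with Ξ takes values in the plane and disappears for the same
reason as the Θ term (`upsilonDot_coord`), which is why Ξ is arbitrary. The velocity of the slope is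
Q̇ P⁻¹, so the two expressions agree. -/

theorem mdifferentiableAt_trivializationAt_snd [ContMDiffVectorBundle ∞ F V I]
    (w : TotalSpace F V) :
    MDifferentiableAt (I.prod 𝓘(ℝ, F)) 𝓘(ℝ, F) (fun w' => (trivializationAt F V w.1 w').2) w :=
  ((mdifferentiableAt_totalSpace I (id : TotalSpace F V → _) (x₀ := w)).1
    mdifferentiableAt_id).2

/-- The vertical lift is the differential of the inclusion of a fibre, and the fibre coordinate is a
left inverse of that inclusion; the chain rule gives the identity. -/
theorem mfderiv_trivializationAt_verticalLift [ContMDiffVectorBundle ∞ F V I]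
    (w : TotalSpace F V) (z : V w.1) :
    (mfderiv (I.prod 𝓘(ℝ, F)) 𝓘(ℝ, F) (fun w' => (trivializationAt F V w.1 w').2) w
      (verticalLift (I := I) w z) : F) =
      (trivializationAt F V w.1).continuousLinearMapAt ℝ w.1 z := by
  set e := trivializationAt F V w.1
  have hb : w.1 ∈ e.baseSet := FiberBundle.mem_baseSet_trivializationAt' w.1
  let g : F → TotalSpace F V := fun f => ⟨w.1, e.symmL ℝ w.1 f⟩
  have hg : ∀ f, (e (g f)).2 = f := fun f => by
    change (e ⟨w.1, e.symmL ℝ w.1 f⟩).2 = f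
    rw [Trivialization.symmL_apply _ hb, e.apply_mk_symm hb]
  -- The point `w` equals `g` of its own coordinate only propositionally. Quantifying over `w'`,
  -- with all tangent spaces read as their model spaces, lets the equality be eliminated without
  -- transport.
  have key : ∀ (f₀ f : F) (w' : TotalSpace F V), g f₀ = w' →
      (mfderiv (I.prod 𝓘(ℝ, F)) 𝓘(ℝ, F) (fun w'' => (e w'').2) w' : EB × F →L[ℝ] F)
        ((mfderiv 𝓘(ℝ, F) (I.prod 𝓘(ℝ, F)) g f₀ : F →L[ℝ] EB × F) f) = f := by
    rintro f₀ f _ rfl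
    have h1 : MDifferentiableAt 𝓘(ℝ, F) (I.prod 𝓘(ℝ, F)) g f₀ := by
      refine (mdifferentiableAt_totalSpace I g).2 ⟨mdifferentiableAt_const, ?_⟩
      -- A map into the total space is tested on its projection, here constant, and on its fibre
      -- coordinate, here the identity.
      refine MDifferentiableAt.congr_of_eventuallyEq mdifferentiableAt_id ?_
      exact Filter.Eventually.of_forall hg
    have h2 : MDifferentiableAt (I.prod 𝓘(ℝ, F)) 𝓘(ℝ, F) (fun w'' => (e w'').2) (g f₀) :=
      mdifferentiableAt_trivializationAt_snd (g f₀)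
    have hc := h2.hasMFDerivAt.comp f₀ h1.hasMFDerivAt
    have hid : (fun w'' => (e w'').2) ∘ g = id := funext hg
    rw [hid] at hc
    exact DFunLike.congr_fun (hasMFDerivAt_unique hc (hasMFDerivAt_id f₀)) f
  refine key _ _ _ ?_
  have h2 : (e w).2 = e.continuousLinearMapAt ℝ w.1 w.2 := by
    exact (congrFun (e.coe_linearMapAt_of_mem (R := ℝ) hb) w.2).symm
  change (⟨w.1, e.symmL ℝ w.1 (e w).2⟩ : TotalSpace F V) = w
  rw [h2, e.symmL_continuousLinearMapAt hb]

/-- The vertical projection of a linear connection in coordinates: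
`dη^k ↦ dη^k + Γ_i{}^k{}_j η^j du^i`. -/
theorem mfderiv_trivializationAt_verticalEnd [ContMDiffVectorBundle ∞ F V I]
    (A : Π b : B, LocalForm I F b) (w : TotalSpace F V)
    (ξ : TangentSpace (I.prod 𝓘(ℝ, F)) w) :
    (mfderiv (I.prod 𝓘(ℝ, F)) 𝓘(ℝ, F) (fun w' => (trivializationAt F V w.1 w').2) w
      (verticalEnd A w ξ : TangentSpace (I.prod 𝓘(ℝ, F)) w) : F) =
      (show F from mfderiv (I.prod 𝓘(ℝ, F)) 𝓘(ℝ, F)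
        (fun w' => (trivializationAt F V w.1 w').2) w ξ) +
      A w.1 (mfderiv (I.prod 𝓘(ℝ, F)) I (TotalSpace.proj : TotalSpace F V → B) w ξ)
        (trivializationAt F V w.1 w).2 :=
  (mfderiv_trivializationAt_verticalLift w (verticalProj A w ξ)).trans
    ((trivializationAt F V w.1).continuousLinearMapAt_symmL (R := ℝ)
      (FiberBundle.mem_baseSet_trivializationAt' w.1) _)

end Vertical

/-! ### The prolongation in coordinates -/

section Prolongation

variable {n m : ℕ} {M E : Type*} [TopologicalSpace M] [ChartedSpace (Rn n) M]
  [IsManifold 𝓘(ℝ, Rn n) ∞ M]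
  [TopologicalSpace E] [ChartedSpace (Rn (n + m)) E] [IsManifold 𝓘(ℝ, Rn (n + m)) ∞ E]

/-- The fibre coordinates of jets in the preferred trivialization at the base point of `Φ`. -/
def ParJet.fibreCoord (Φ Φ' : ParJet n m M E) : Rn n →L[ℝ] Rn (n + m) :=
  (trivializationAt (Rn n →L[ℝ] Rn (n + m)) (ParJetFibre n m M E) Φ.1 Φ').2

/-- The block `∂u^λ/∂x` of the fibre coordinates of a jet. -/
def DividedChart.parFst (c : DividedChart n m E) (A : Rn n →L[ℝ] Rn (n + m)) :
    Rn n →L[ℝ] Rn n :=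
  ((ContinuousLinearMap.fst ℝ (Rn n) (Rn m)).comp
    (c.split : Rn (n + m) →L[ℝ] Rn n × Rn m)).comp A

/-- The block `∂u^i/∂x` of the fibre coordinates of a jet. -/
def DividedChart.parSnd (c : DividedChart n m E) (A : Rn n →L[ℝ] Rn (n + m)) :
    Rn n →L[ℝ] Rn m :=
  ((ContinuousLinearMap.snd ℝ (Rn n) (Rn m)).comp
    (c.split : Rn (n + m) →L[ℝ] Rn n × Rn m)).comp A

/-- A trivialization of a Hom bundle conjugates by the trivializations of its factors. On the `M`
side only bijectivity is retained, since images and injectivity do not change under a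
reparametrization of the source. -/
theorem ParJet.exists_fibreCoord_eq (Φ Φ' : ParJet n m M E)
    (hM : Φ'.1.1 ∈ (chartAt (Rn n) Φ.1.1).source)
    (hE : Φ'.1.2 ∈ (chartAt (Rn (n + m)) Φ.1.2).source) :
    ∃ S : Rn n →ₗ[ℝ] TangentSpace 𝓘(ℝ, Rn n) Φ'.1.1, Function.Bijective S ∧
      ∀ z, Φ.fibreCoord Φ' z = mfderiv 𝓘(ℝ, Rn (n + m)) 𝓘(ℝ, Rn (n + m))
        (chartAt (Rn (n + m)) Φ.1.2) Φ'.1.2 (ParJet.tangentMap Φ' (S z)) := by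
  set e := trivializationAt (Rn n)
    (PullFibre (prM n m M E) (TangentSpace 𝓘(ℝ, Rn n) : M → Type)) Φ.1
  have hb : Φ'.1 ∈ e.baseSet := hM
  refine ⟨(e.symmL ℝ Φ'.1).toLinearMap, ?_, ?_⟩
  · exact Function.bijective_iff_has_inverse.2 ⟨e.continuousLinearMapAt ℝ Φ'.1,
      e.continuousLinearMapAt_symmL (R := ℝ) hb, e.symmL_continuousLinearMapAt (R := ℝ) hb⟩
  · intro z
    have h2 : Φ.fibreCoord Φ' z = (trivializationAt (Rn (n + m))
        (TangentSpace 𝓘(ℝ, Rn (n + m)) : E → Type) Φ.1.2).continuousLinearMapAt ℝ Φ'.1.2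
          (ParJet.tangentMap Φ' (e.symmL ℝ Φ'.1 z)) := rfl
    rw [h2, TangentBundle.continuousLinearMapAt_trivializationAt hE]
    rfl

/-- The chart of `c` must be the one that trivializes `TE` at the base point of `Φ`, so that
`c.diff` and the fibre coordinates differ only by the splitting, which stays free. -/
theorem map_diff_range_tangentMap (Φ Φ' : ParJet n m M E) (c : DividedChart n m E)
    (hc : c.chart = chartAt (Rn (n + m)) Φ.1.2)
    (hM : Φ'.1.1 ∈ (chartAt (Rn n) Φ.1.1).source) (hE : Φ'.1.2 ∈ c.chart.source) :
    (LinearMap.range (ParJet.tangentMap Φ').toLinearMap).map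
      (c.diff Φ'.1.2 : TangentSpace 𝓘(ℝ, Rn (n + m)) Φ'.1.2 →ₗ[ℝ] Rn n × Rn m) =
      LinearMap.range (((c.parFst (Φ.fibreCoord Φ')).prod (c.parSnd (Φ.fibreCoord Φ')) :
        Rn n →L[ℝ] Rn n × Rn m) : Rn n →ₗ[ℝ] Rn n × Rn m) := by
  rw [hc] at hE
  obtain ⟨S, hS, h⟩ := Φ.exists_fibreCoord_eq Φ' hM hE
  have key : ∀ z, c.split (Φ.fibreCoord Φ' z) = c.diff Φ'.1.2 (ParJet.tangentMap Φ' (S z)) := by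
    intro z
    rw [h, ← hc]
    rfl
  ext a
  constructor
  · rintro ⟨_, ⟨y, rfl⟩, rfl⟩
    obtain ⟨z, rfl⟩ := hS.2 y
    exact ⟨z, key z⟩
  · rintro ⟨z, rfl⟩
    exact ⟨_, ⟨S z, rfl⟩, (key z).symm⟩

/-- A left inverse of the first block is enough for injectivity. As units form an open set, this
keeps all jets near an immersion in `immJet`, away from the default values of `prolongE`. -/
theorem mem_immJet_of_isUnit (Φ Φ' : ParJet n m M E) (c : DividedChart n m E)
    (hM : Φ'.1.1 ∈ (chartAt (Rn n) Φ.1.1).source)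
    (hE : Φ'.1.2 ∈ (chartAt (Rn (n + m)) Φ.1.2).source)
    (hu : IsUnit (c.parFst (Φ.fibreCoord Φ'))) : Φ' ∈ immJet n m M E := by
  obtain ⟨S, hS, h⟩ := Φ.exists_fibreCoord_eq Φ' hM hE
  intro y y' hy
  obtain ⟨z, rfl⟩ := hS.2 y
  obtain ⟨z', rfl⟩ := hS.2 y'
  have h1 : Φ.fibreCoord Φ' z = Φ.fibreCoord Φ' z' := by rw [h, h, hy]
  have h2 : c.parFst (Φ.fibreCoord Φ') z = c.parFst (Φ.fibreCoord Φ') z' :=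
    congrArg (fun v => (c.split v).1) h1
  have h3 := congrArg (fun x => Ring.inverse (c.parFst (Φ.fibreCoord Φ')) x) h2
  have h4 : ∀ x, Ring.inverse (c.parFst (Φ.fibreCoord Φ')) (c.parFst (Φ.fibreCoord Φ') x) = x :=
    fun x => DFunLike.congr_fun (Ring.inverse_mul_cancel _ hu) x
  simp only [h4] at h3
  rw [h3]

omit [IsManifold 𝓘(ℝ, Rn n) ∞ M] [IsManifold 𝓘(ℝ, Rn (n + m)) ∞ E] in
theorem prolongE_eq {Φ : ParJet n m M E} (h : Φ ∈ immJet n m M E) :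
    prolongE Φ = ⟨Φ.1.2, LinearMap.range (ParJet.tangentMap Φ).toLinearMap,
      (LinearMap.finrank_range_of_inj h).trans (finrank_euclideanSpace_fin (𝕜 := ℝ))⟩ :=
  dif_pos _

/-- The coordinates `(u^λ, u^i, u^i_λ)` of the prolongation of a jet. -/
def DividedChart.prolongCoord (c : DividedChart n m E) (Φ Φ' : ParJet n m M E) :
    (Rn n × Rn m) × (Rn n →L[ℝ] Rn m) :=
  (c.coord Φ'.1.2, (c.parSnd (Φ.fibreCoord Φ')).comp
    (Ring.inverse (c.parFst (Φ.fibreCoord Φ'))))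

/-- With an invertible first block P, the range of (P, Q) is the graph of Q P⁻¹. The hypothesis `hu`
makes `Ring.inverse` a true inverse. -/
theorem jetHomeo_prolongE (Φ Φ' : ParJet n m M E) (c : DividedChart n m E)
    (hc : c.chart = chartAt (Rn (n + m)) Φ.1.2)
    (hM : Φ'.1.1 ∈ (chartAt (Rn n) Φ.1.1).source) (hE : Φ'.1.2 ∈ c.chart.source)
    (hu : IsUnit (c.parFst (Φ.fibreCoord Φ'))) :
    prolongE Φ' ∈ c.domain ∧ c.jetHomeo (prolongE Φ') = c.prolongCoord Φ Φ' := by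
  have hi := mem_immJet_of_isUnit Φ Φ' c hM (hc ▸ hE) hu
  have h := (map_diff_range_tangentMap Φ Φ' c hc hM hE).trans (range_prod_of_isUnit _ hu)
  rw [prolongE_eq hi]
  refine ⟨⟨hE, _, h⟩, ?_⟩
  exact Prod.ext rfl ((congrArg graphSlope h).trans (graphSlope_graph _))

/-- The preferred chart sends the plane to ℝⁿ × 0, the graph of the zero map, and the range of the
two blocks is this graph. The plane is named by a variable `θ` with an equation, so that `prolongE
Φ` can be unfolded under the types that depend on it. -/
theorem preferredChart_parCoord {Φ : ParJet n m M E} (h : Φ ∈ immJet n m M E)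
    {θ : JetSub n m E} (hθ : prolongE Φ = θ) :
    IsUnit ((preferredChart θ).parFst (Φ.fibreCoord Φ)) ∧
      (preferredChart θ).parSnd (Φ.fibreCoord Φ) = 0 := by
  rw [prolongE_eq h] at hθ
  subst hθ
  have h1 := map_preferredChart (⟨Φ.1.2, LinearMap.range (ParJet.tangentMap Φ).toLinearMap,
    (LinearMap.finrank_range_of_inj h).trans (finrank_euclideanSpace_fin (𝕜 := ℝ))⟩ :
      JetSub n m E)
  have hmem := mem_preferredChart_domain (⟨Φ.1.2,
    LinearMap.range (ParJet.tangentMap Φ).toLinearMap,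
    (LinearMap.finrank_range_of_inj h).trans (finrank_euclideanSpace_fin (𝕜 := ℝ))⟩ :
      JetSub n m E)
  have h2 := (map_diff_range_tangentMap Φ Φ _ (preferredChart_chart _) (mem_chart_source _ _)
    hmem.1).symm.trans h1
  refine ⟨range_prod_eq_graph (B := 0) h2, ?_⟩
  ext1 z
  have h3 : (((preferredChart _).parFst (Φ.fibreCoord Φ)).prod
    ((preferredChart _).parSnd (Φ.fibreCoord Φ))) z ∈ (0 : Rn n →ₗ[ℝ] Rn m).graph :=
    h2 ▸ LinearMap.mem_range_self _ z
  exact h3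

omit [IsManifold 𝓘(ℝ, Rn n) ∞ M] in
theorem chart_of_prolongE_eq {Φ : ParJet n m M E} (h : Φ ∈ immJet n m M E)
    {θ : JetSub n m E} (hθ : prolongE Φ = θ) :
    (preferredChart θ).chart = chartAt (Rn (n + m)) Φ.1.2 := by
  rw [prolongE_eq h] at hθ
  subst hθ
  exact preferredChart_chart _

end Prolongation

/-! ### Smoothness and differential of the prolongation -/

/-- In the product rule the derivative of `g` is multiplied by `f x = 0`. Thus the derivative of P ↦
P⁻¹ never has to be computed. -/
theorem HasFDerivAt.clm_comp_of_eq_zero {X F₁ F₂ F₃ : Type*}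
    [NormedAddCommGroup X] [NormedSpace ℝ X] [NormedAddCommGroup F₁] [NormedSpace ℝ F₁]
    [NormedAddCommGroup F₂] [NormedSpace ℝ F₂] [NormedAddCommGroup F₃] [NormedSpace ℝ F₃]
    {f : X → F₂ →L[ℝ] F₃} {f' : X →L[ℝ] F₂ →L[ℝ] F₃} {g : X → F₁ →L[ℝ] F₂} {x : X}
    (hf : HasFDerivAt f f' x) (h0 : f x = 0) (hg : DifferentiableAt ℝ g x) :
    HasFDerivAt (fun y => (f y).comp (g y))
      (((ContinuousLinearMap.compL ℝ F₁ F₂ F₃).flip (g x)).comp f') x := by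
  refine (hf.clm_comp hg.hasFDerivAt).congr_fderiv ?_
  ext y z
  change f x (fderiv ℝ g x y z) + f' y (g x z) = f' y (g x z)
  rw [h0, zero_apply, zero_add]

section Prolongation

variable {n m : ℕ} {M E : Type*} [TopologicalSpace M] [ChartedSpace (Rn n) M]
  [IsManifold 𝓘(ℝ, Rn n) ∞ M]
  [TopologicalSpace E] [ChartedSpace (Rn (n + m)) E] [IsManifold 𝓘(ℝ, Rn (n + m)) ∞ E]

omit [IsManifold 𝓘(ℝ, Rn (n + m)) ∞ E] in
theorem DividedChart.contDiff_parFst (c : DividedChart n m E) : ContDiff ℝ ∞ c.parFst :=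
  contDiff_const.clm_comp contDiff_id

omit [IsManifold 𝓘(ℝ, Rn (n + m)) ∞ E] in
theorem DividedChart.contDiff_parSnd (c : DividedChart n m E) : ContDiff ℝ ∞ c.parSnd :=
  contDiff_const.clm_comp contDiff_id

omit [IsManifold 𝓘(ℝ, Rn (n + m)) ∞ E] in
theorem DividedChart.contDiffAt_slope (c : DividedChart n m E) {A₀ : Rn n →L[ℝ] Rn (n + m)}
    (hu : IsUnit (c.parFst A₀)) :
    ContDiffAt ℝ ∞ (fun A => (c.parSnd A).comp (Ring.inverse (c.parFst A))) A₀ := by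
  obtain ⟨u, hu⟩ := hu
  have h := contDiffAt_ringInverse ℝ (n := ∞) u
  rw [hu] at h
  exact c.contDiff_parSnd.contDiffAt.clm_comp (h.comp A₀ c.contDiff_parFst.contDiffAt)

omit [IsManifold 𝓘(ℝ, Rn (n + m)) ∞ E] in
/-- At a jet whose second block vanishes, only the second block contributes to the derivative of
the slope. -/
theorem DividedChart.hasFDerivAt_slope (c : DividedChart n m E) {A₀ : Rn n →L[ℝ] Rn (n + m)}
    (hu : IsUnit (c.parFst A₀)) (h0 : c.parSnd A₀ = 0) :
    HasFDerivAt (fun A => (c.parSnd A).comp (Ring.inverse (c.parFst A)))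
      (((ContinuousLinearMap.compL ℝ (Rn n) (Rn n) (Rn m)).flip
        (Ring.inverse (c.parFst A₀))).comp
        (ContinuousLinearMap.compL ℝ (Rn n) (Rn (n + m)) (Rn m)
          ((ContinuousLinearMap.snd ℝ (Rn n) (Rn m)).comp
            (c.split : Rn (n + m) →L[ℝ] Rn n × Rn m)))) A₀ := by
  have h1 : HasFDerivAt c.parSnd (ContinuousLinearMap.compL ℝ (Rn n) (Rn (n + m)) (Rn m)
      ((ContinuousLinearMap.snd ℝ (Rn n) (Rn m)).comp
        (c.split : Rn (n + m) →L[ℝ] Rn n × Rn m))) A₀ :=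
    (ContinuousLinearMap.compL ℝ (Rn n) (Rn (n + m)) (Rn m)
      ((ContinuousLinearMap.snd ℝ (Rn n) (Rn m)).comp
        (c.split : Rn (n + m) →L[ℝ] Rn n × Rn m))).hasFDerivAt
  obtain ⟨u, hu⟩ := hu
  have h := contDiffAt_ringInverse ℝ (n := ∞) u
  rw [hu] at h
  -- The inverse of the first block enters only through its differentiability at `A₀`.
  exact h1.clm_comp_of_eq_zero h0
    ((h.comp A₀ c.contDiff_parFst.contDiffAt).differentiableAt (by simp))

theorem contMDiffAt_fibreCoord (Φ : ParJet n m M E) :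
    ContMDiffAt (ParJetModel n m) 𝓘(ℝ, Rn n →L[ℝ] Rn (n + m)) ∞ Φ.fibreCoord Φ :=
  ((Bundle.contMDiffAt_totalSpace (n := ∞)
    (IM := (𝓘(ℝ, Rn n).prod 𝓘(ℝ, Rn (n + m))).prod 𝓘(ℝ, Rn n →L[ℝ] Rn (n + m)))
    (IB := 𝓘(ℝ, Rn n).prod 𝓘(ℝ, Rn (n + m))) (x₀ := Φ)
    (f := (id : ParJet n m M E → ParJet n m M E))).1 contMDiffAt_id).2

theorem contMDiffAt_pt (Φ : ParJet n m M E) :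
    ContMDiffAt (ParJetModel n m) 𝓘(ℝ, Rn (n + m)) ∞
      (fun Φ' : ParJet n m M E => Φ'.1.2) Φ :=
  contMDiffAt_snd.comp Φ (Bundle.contMDiffAt_proj (ParJetFibre n m M E))

theorem DividedChart.contMDiffAt_prolongCoord (c : DividedChart n m E) {Φ : ParJet n m M E}
    (hE : Φ.1.2 ∈ c.chart.source) (hu : IsUnit (c.parFst (Φ.fibreCoord Φ))) :
    ContMDiffAt (ParJetModel n m) 𝓘(ℝ, (Rn n × Rn m) × (Rn n →L[ℝ] Rn m)) ∞
      (c.prolongCoord Φ) Φ := by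
  have h1 : ContMDiffAt 𝓘(ℝ, Rn (n + m)) 𝓘(ℝ, Rn n × Rn m) ∞ c.coord Φ.1.2 :=
    c.split.contDiff.contMDiff.contMDiffAt.comp Φ.1.2 ((contMDiffOn_of_mem_maximalAtlas
      (IsManifold.subset_maximalAtlas c.mem)).contMDiffAt (c.chart.open_source.mem_nhds hE))
  have h2 := h1.comp Φ (contMDiffAt_pt Φ)
  have h3 := (c.contDiffAt_slope hu).contMDiffAt.comp Φ (contMDiffAt_fibreCoord Φ)
  exact h2.prodMk_space h3

/-- The coordinate formula rests on three open conditions: both base points lie in chart domains and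
the first block is a unit. Validity on a neighbourhood, not only at `Φ`, is what allows the formula
to be differentiated. -/
theorem eventually_jetHomeo_prolongE {Φ : ParJet n m M E} (c : DividedChart n m E)
    (hc : c.chart = chartAt (Rn (n + m)) Φ.1.2) (hu : IsUnit (c.parFst (Φ.fibreCoord Φ))) :
    ∀ᶠ Φ' in 𝓝 Φ, prolongE Φ' ∈ c.domain ∧ c.jetHomeo (prolongE Φ') = c.prolongCoord Φ Φ' := by
  have hproj := FiberBundle.continuous_proj (Rn n →L[ℝ] Rn (n + m)) (ParJetFibre n m M E)
  have h1 : ∀ᶠ Φ' : ParJet n m M E in 𝓝 Φ, Φ'.1.1 ∈ (chartAt (Rn n) Φ.1.1).source :=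
    (continuous_fst.comp hproj).continuousAt.preimage_mem_nhds
      ((chartAt (Rn n) Φ.1.1).open_source.mem_nhds (mem_chart_source _ _))
  have h2 : ∀ᶠ Φ' : ParJet n m M E in 𝓝 Φ, Φ'.1.2 ∈ c.chart.source :=
    (continuous_snd.comp hproj).continuousAt.preimage_mem_nhds
      (c.chart.open_source.mem_nhds (hc ▸ mem_chart_source _ _))
  have h3 : ∀ᶠ Φ' : ParJet n m M E in 𝓝 Φ, IsUnit (c.parFst (Φ.fibreCoord Φ')) :=
    (c.contDiff_parFst.continuous.continuousAt.comp
      (contMDiffAt_fibreCoord Φ).continuousAt).preimage_mem_nhds (Units.isOpen.mem_nhds hu)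
  filter_upwards [h1, h2, h3] with Φ' h1 h2 h3
  exact jetHomeo_prolongE Φ Φ' c hc h1 h2 h3

theorem contMDiffAt_prolongE {Φ : ParJet n m M E} (h : Φ ∈ immJet n m M E) :
    ContMDiffAt (ParJetModel n m) 𝓘(ℝ, (Rn n × Rn m) × (Rn n →L[ℝ] Rn m)) ∞
      (prolongE : ParJet n m M E → JetSub n m E) Φ := by
  have hu := (preferredChart_parCoord h rfl).1
  have hc := chart_of_prolongE_eq h rfl
  set c := preferredChart (prolongE Φ)
  have hev := eventually_jetHomeo_prolongE c hc hu
  have h1 := c.contMDiffAt_prolongCoord (hc ▸ mem_chart_source _ _) hu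
  have h2 : ContMDiffAt 𝓘(ℝ, (Rn n × Rn m) × (Rn n →L[ℝ] Rn m))
      𝓘(ℝ, (Rn n × Rn m) × (Rn n →L[ℝ] Rn m)) ∞ c.jetHomeo.symm (c.jetHomeo (prolongE Φ)) :=
    (contMDiffOn_symm_of_mem_maximalAtlas (IsManifold.subset_maximalAtlas
      (mem_atlas_jetSub_iff.2 ⟨c, rfl⟩))).contMDiffAt
      (c.jetHomeo.open_target.mem_nhds (c.jetHomeo.map_source hev.self_of_nhds.1))
  refine (ContMDiffAt.comp_of_eq (x := Φ) h2 h1 hev.self_of_nhds.2.symm).congr_of_eventuallyEq ?_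
  filter_upwards [hev] with Φ' hΦ'
  -- The coordinate expression followed by the inverse chart has the same germ at `Φ` as the
  -- prolongation.
  change _ = c.jetHomeo.symm (c.prolongCoord Φ Φ')
  rw [← hΦ'.2]
  exact (c.jetHomeo.left_inv hΦ'.1).symm

/-- The differential of the prolongation in coordinates. -/
theorem mfderiv_prolongE {Φ : ParJet n m M E} (h : Φ ∈ immJet n m M E)
    {θ : JetSub n m E} (hθ : prolongE Φ = θ) (ξ : TangentSpace (ParJetModel n m) Φ) :
    (mfderiv (ParJetModel n m) 𝓘(ℝ, (Rn n × Rn m) × (Rn n →L[ℝ] Rn m)) prolongE Φ ξ :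
      (Rn n × Rn m) × (Rn n →L[ℝ] Rn m)) =
    ((preferredChart θ).diff Φ.1.2 (mfderiv (ParJetModel n m) 𝓘(ℝ, Rn (n + m))
        (fun Φ' : ParJet n m M E => Φ'.1.2) Φ ξ),
      ((preferredChart θ).parSnd (show Rn n →L[ℝ] Rn (n + m) from
        mfderiv (ParJetModel n m) 𝓘(ℝ, Rn n →L[ℝ] Rn (n + m)) Φ.fibreCoord Φ ξ)).comp
        (Ring.inverse ((preferredChart θ).parFst (Φ.fibreCoord Φ)))) := by
  obtain ⟨hu, h0⟩ := preferredChart_parCoord h hθ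
  have hc := chart_of_prolongE_eq h hθ
  have hev := eventually_jetHomeo_prolongE (preferredChart θ) hc hu
  have hE : Φ.1.2 ∈ (preferredChart θ).chart.source := hc ▸ mem_chart_source _ _
  have h1 := ((preferredChart θ).hasMFDerivAt_coord hE).comp Φ
    ((contMDiffAt_pt Φ).mdifferentiableAt (by simp)).hasMFDerivAt
  have h2 := ((preferredChart θ).hasFDerivAt_slope hu h0).hasMFDerivAt.comp Φ
    ((contMDiffAt_fibreCoord Φ).mdifferentiableAt (by simp)).hasMFDerivAt
  have h3 := h1.prodMk h2
  have h4 := ((contMDiffAt_prolongE h).mdifferentiableAt (by simp)).hasMFDerivAt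
  subst hθ
  -- The tangent space at a point of `J¹(E,n)` is modelled by the preferred chart there, whose
  -- differential at that point is the identity. The differential of the coordinate expression is
  -- therefore the differential of `prolongE` itself.
  have h5 := (hasMFDerivAt_jetChart (prolongE Φ)).comp Φ h4
  have h6 := h3.congr_of_eventuallyEq (hev.mono fun Φ' hΦ' => hΦ'.2)
  exact DFunLike.congr_fun (hasMFDerivAt_unique h5 h6) ξ

end Prolongation

/-! ### The connection on `J¹(E,n)` in coordinates -/

section DotConnection

variable {n m : ℕ} {E : Type*} [TopologicalSpace E] [ChartedSpace (Rn (n + m)) E]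
  [IsManifold 𝓘(ℝ, Rn (n + m)) ∞ E]

-- Precomposing `N` with `X` keeps the values in the kernel of the second block, so a connection on
-- the source factor of a Hom bundle becomes invisible. It is applied with `X` coming from Ξ on one
-- side and from Θ on the other.
omit [IsManifold 𝓘(ℝ, Rn (n + m)) ∞ E] in
theorem DividedChart.parSnd_hom_connection (c : DividedChart n m E)
    {H N : Rn n →L[ℝ] Rn (n + m)} (G : Rn (n + m) →L[ℝ] Rn (n + m)) (X : Rn n →L[ℝ] Rn n)
    (hN : c.parSnd N = 0) :
    c.parSnd (H + (G.comp N - N.comp X)) = c.parSnd H + c.parSnd (G.comp N) := by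
  have h : c.parSnd (N.comp X) = (c.parSnd N).comp X := rfl
  rw [hN, ContinuousLinearMap.zero_comp] at h
  have h' : ∀ A B, c.parSnd (A + B) = c.parSnd A + c.parSnd B := fun A B =>
    ContinuousLinearMap.comp_add _ A B
  have h'' : ∀ A B, c.parSnd (A - B) = c.parSnd A - c.parSnd B := fun A B =>
    ContinuousLinearMap.comp_sub _ A B
  rw [h', h'', h, sub_zero]

/-- Passing to the quotient by the plane amounts to keeping the components `du^i`, as the plane is
ℝⁿ × 0 in the preferred chart. -/
theorem normalCoord_idTensorOmega_symmL (θ : JetSub n m E) (Ψ : Rn n →L[ℝ] Rn (n + m))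
    (y : Horiz θ) :
    normalCoord θ (idTensorOmega θ ((trivializationAt (Rn n →L[ℝ] Rn (n + m))
      (JetHom : JetSub n m E → Type) θ).symmL ℝ θ Ψ) y) =
      (preferredChart θ).parSnd Ψ ((preferredChart θ).horizCoord θ y) := by
  have h1 := tangentTriv_symmL_self θ.pt (Ψ ((preferredChart θ).horizCoord θ y))
  rw [← preferredChart_chart] at h1
  have h2 := congrArg (fun z => ((preferredChart θ).split z).2) h1
  refine Eq.trans ?_ h2
  exact congrArg (fun x => ((preferredChart θ).diff θ.pt x).2)
    (trivializationAt_jetHom_symmL θ Ψ y)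

theorem jetSlope_preferredChart (θ : JetSub n m E) : (preferredChart θ).jetSlope θ = 0 :=
  (congrArg graphSlope (map_preferredChart θ)).trans (graphSlope_graph 0)

theorem mfderiv_proj_tangentD1 (θ : JetSub n m E)
    (v : TangentSpace 𝓘(ℝ, (Rn n × Rn m) × (Rn n →L[ℝ] Rn m)) θ) :
    mfderiv (𝓘(ℝ, (Rn n × Rn m) × (Rn n →L[ℝ] Rn m)).prod 𝓘(ℝ, Rn n →L[ℝ] Rn (n + m)))
      𝓘(ℝ, (Rn n × Rn m) × (Rn n →L[ℝ] Rn m)) (TotalSpace.proj :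
        TotalSpace (Rn n →L[ℝ] Rn (n + m)) (JetHom : JetSub n m E → Type) → JetSub n m E)
      (D1 θ) (tangentD1 θ v) = v := by
  have h1 := ((Bundle.contMDiffAt_proj (n := ∞)
    (IB := 𝓘(ℝ, (Rn n × Rn m) × (Rn n →L[ℝ] Rn m))) (JetHom : JetSub n m E → Type)
    (p := D1 θ)).mdifferentiableAt (by simp)).hasMFDerivAt.comp θ
    (mdifferentiableAt_D1 θ).hasMFDerivAt
  exact DFunLike.congr_fun (hasMFDerivAt_unique h1 (hasMFDerivAt_id θ)) v

/-- The vertical projection of the connection on `π_{1,0}` in coordinates. -/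
theorem upsilonDot_coord (Γ : CovariantDerivative 𝓘(ℝ, Rn (n + m)) (Rn (n + m))
      (TangentSpace 𝓘(ℝ, Rn (n + m)) : E → Type))
    (Ξ : CovariantDerivative 𝓘(ℝ, (Rn n × Rn m) × (Rn n →L[ℝ] Rn m)) (Rn n)
      (Horiz : JetSub n m E → Type)) (θ : JetSub n m E)
    (v : TangentSpace 𝓘(ℝ, (Rn n × Rn m) × (Rn n →L[ℝ] Rn m)) θ) :
    (show (Rn n × Rn m) × (Rn n →L[ℝ] Rn m) from
      (upsilonDot Γ Ξ θ v : TangentSpace 𝓘(ℝ, (Rn n × Rn m) × (Rn n →L[ℝ] Rn m)) θ)) =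
    (0, (show (Rn n × Rn m) × (Rn n →L[ℝ] Rn m) from v).2 +
      (preferredChart θ).parSnd ((christoffel Γ θ.pt
        (mfderiv 𝓘(ℝ, (Rn n × Rn m) × (Rn n →L[ℝ] Rn m)) 𝓘(ℝ, Rn (n + m))
          (JetSub.pt : JetSub n m E → E) θ v)).comp
        (((preferredChart θ).split.symm : Rn n × Rn m →L[ℝ] Rn (n + m)).comp
          (ContinuousLinearMap.inl ℝ (Rn n) (Rn m))))) := by
  set u := upsilonDot Γ Ξ θ v
  refine Prod.ext ((mem_jetVertical_iff θ _).1 u.2) ?_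
  ext1 z
  obtain ⟨y, rfl⟩ := ((preferredChart θ).horizCoord_bijective (mem_preferredChart_domain θ)).2 z
  -- The slope component of a tangent vector is recovered from its image under `derivD1`; for the
  -- vertical vector `u` this image undoes the `jetVerticalEquiv.symm` in the definition of
  -- `upsilonDot`.
  refine (normalCoord_derivD1 θ u y).symm.trans ?_
  have h1 : derivD1 θ u = idTensorOmega θ (verticalProj (homForm (christoffel Ξ)
      (pullbackForm jetProj (christoffel Γ))) (D1 θ) (tangentD1 θ v)) :=
    (jetVerticalEquiv θ).apply_symm_apply _
  rw [h1]
  refine (normalCoord_idTensorOmega_symmL θ _ y).trans ?_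
  have h2 := mfderiv_trivialization_tangentD1 θ v
  have h3 := mfderiv_proj_tangentD1 θ v
  have h4 := trivialization_D1 θ (mem_preferredChart_domain θ)
  rw [jetSlope_preferredChart] at h4
  -- The value of `D1` at `θ` has zero second block: an inclusion becomes zero modulo its image.
  -- This is the condition under which the Ξ term drops out in `h6`.
  have h5 : (preferredChart θ).parSnd
      (((preferredChart θ).split.symm : Rn n × Rn m →L[ℝ] Rn (n + m)).comp
        ((ContinuousLinearMap.id ℝ (Rn n)).prod 0)) = 0 := by
    ext1 x
    change ((preferredChart θ).split ((preferredChart θ).split.symm (x, 0))).2 = 0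
    rw [ContinuousLinearEquiv.apply_symm_apply]
  have h6 := fun H => (preferredChart θ).parSnd_hom_connection (H := H)
    (christoffel Γ θ.pt (mfderiv 𝓘(ℝ, (Rn n × Rn m) × (Rn n →L[ℝ] Rn m)) 𝓘(ℝ, Rn (n + m))
          (JetSub.pt : JetSub n m E → E) θ
      (mfderiv (𝓘(ℝ, (Rn n × Rn m) × (Rn n →L[ℝ] Rn m)).prod 𝓘(ℝ, Rn n →L[ℝ] Rn (n + m)))
      𝓘(ℝ, (Rn n × Rn m) × (Rn n →L[ℝ] Rn m)) (TotalSpace.proj :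
        TotalSpace (Rn n →L[ℝ] Rn (n + m)) (JetHom : JetSub n m E → Type) → JetSub n m E)
      (D1 θ) (tangentD1 θ v))))
    (christoffel Ξ θ
      (mfderiv (𝓘(ℝ, (Rn n × Rn m) × (Rn n →L[ℝ] Rn m)).prod 𝓘(ℝ, Rn n →L[ℝ] Rn (n + m)))
      𝓘(ℝ, (Rn n × Rn m) × (Rn n →L[ℝ] Rn m)) (TotalSpace.proj :
        TotalSpace (Rn n →L[ℝ] Rn (n + m)) (JetHom : JetSub n m E → Type) → JetSub n m E)
      (D1 θ) (tangentD1 θ v))) ((congrArg (preferredChart θ).parSnd h4).trans h5)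
  refine DFunLike.congr_fun ((h6 _).trans ?_) _
  refine congrArg₂ (· + ·) ((congrArg (preferredChart θ).parSnd h2).trans ?_) ?_
  · ext1 x
    change ((preferredChart θ).split ((preferredChart θ).split.symm (0, _))).2 = _
    rw [ContinuousLinearEquiv.apply_symm_apply]
    rfl
  · rw [h3, h4]
    rfl

end DotConnection

/-! ### Comparison of the two vertical projections -/

section Quotient

variable {n m : ℕ} {M E : Type*} [TopologicalSpace M] [ChartedSpace (Rn n) M]
  [IsManifold 𝓘(ℝ, Rn n) ∞ M]
  [TopologicalSpace E] [ChartedSpace (Rn (n + m)) E] [IsManifold 𝓘(ℝ, Rn (n + m)) ∞ E]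

theorem mfderiv_pt_eq (Φ : ParJet n m M E) (ξ : TangentSpace (ParJetModel n m) Φ) :
    mfderiv (ParJetModel n m) 𝓘(ℝ, Rn (n + m)) (fun Φ' : ParJet n m M E => Φ'.1.2) Φ ξ =
      mfderiv ((𝓘(ℝ, Rn n).prod 𝓘(ℝ, Rn (n + m)))) 𝓘(ℝ, Rn (n + m)) (prE n m M E) Φ.1
        (mfderiv (ParJetModel n m) (𝓘(ℝ, Rn n).prod 𝓘(ℝ, Rn (n + m)))
          (TotalSpace.proj : ParJet n m M E → M × E) Φ ξ) := by
  have h1 : HasMFDerivAt (ParJetModel n m) (𝓘(ℝ, Rn n).prod 𝓘(ℝ, Rn (n + m)))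
      (TotalSpace.proj : ParJet n m M E → M × E) Φ _ :=
    ((Bundle.contMDiffAt_proj (n := ∞) (ParJetFibre n m M E)).mdifferentiableAt
      (by simp)).hasMFDerivAt
  have h2 := ((prE n m M E).contMDiff.mdifferentiable (by simp) Φ.1).hasMFDerivAt
  exact DFunLike.congr_fun (hasMFDerivAt_unique
    ((contMDiffAt_pt Φ).mdifferentiableAt (by simp)).hasMFDerivAt (h2.comp Φ h1)) ξ

/-- The vertical projection of the connection on `J¹pr_M` in coordinates. -/
theorem mfderiv_fibreCoord_upsilonDotPar
    (Γ : CovariantDerivative 𝓘(ℝ, Rn (n + m)) (Rn (n + m))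
      (TangentSpace 𝓘(ℝ, Rn (n + m)) : E → Type))
    (Θ : CovariantDerivative 𝓘(ℝ, Rn n) (Rn n) (TangentSpace 𝓘(ℝ, Rn n) : M → Type))
    (Φ : ParJet n m M E) (ξ : TangentSpace (ParJetModel n m) Φ) :
    ∃ X : Rn n →L[ℝ] Rn n,
    (mfderiv (ParJetModel n m) 𝓘(ℝ, Rn n →L[ℝ] Rn (n + m)) Φ.fibreCoord Φ
      (upsilonDotPar Γ Θ Φ ξ) : Rn n →L[ℝ] Rn (n + m)) =
    (show Rn n →L[ℝ] Rn (n + m) from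
      mfderiv (ParJetModel n m) 𝓘(ℝ, Rn n →L[ℝ] Rn (n + m)) Φ.fibreCoord Φ ξ) +
      ((christoffel Γ Φ.1.2 (mfderiv (ParJetModel n m) 𝓘(ℝ, Rn (n + m))
        (fun Φ' : ParJet n m M E => Φ'.1.2) Φ ξ)).comp (Φ.fibreCoord Φ) -
        (Φ.fibreCoord Φ).comp X) := by
  -- The endomorphism is the Christoffel form of Θ on the velocity in `M`. It is hidden behind an
  -- existential because only its position, to the right of the jet, matters later.
  refine ⟨pullbackForm (prM n m M E) (christoffel Θ) Φ.1
    (mfderiv (ParJetModel n m) (𝓘(ℝ, Rn n).prod 𝓘(ℝ, Rn (n + m)))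
      (TotalSpace.proj : ParJet n m M E → M × E) Φ ξ),
    (mfderiv_trivializationAt_verticalEnd _ Φ ξ).trans ?_⟩
  rw [mfderiv_pt_eq]
  rfl

theorem mfderiv_pt_upsilonDotPar
    (Γ : CovariantDerivative 𝓘(ℝ, Rn (n + m)) (Rn (n + m))
      (TangentSpace 𝓘(ℝ, Rn (n + m)) : E → Type))
    (Θ : CovariantDerivative 𝓘(ℝ, Rn n) (Rn n) (TangentSpace 𝓘(ℝ, Rn n) : M → Type))
    (Φ : ParJet n m M E) (ξ : TangentSpace (ParJetModel n m) Φ) :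
    mfderiv (ParJetModel n m) 𝓘(ℝ, Rn (n + m)) (fun Φ' : ParJet n m M E => Φ'.1.2) Φ
      (upsilonDotPar Γ Θ Φ ξ) = 0 := by
  rw [mfderiv_pt_eq]
  exact (congrArg _ (LinearMap.mem_ker.1 (upsilonDotPar Γ Θ Φ ξ).2)).trans (map_zero _)

-- Reparametrizing the source by the inverse of the first block turns the jet into the inclusion of
-- its image, which is the coordinate form of `D1` at that plane. This is the link between the Γ
-- terms of the two connections.
omit [IsManifold 𝓘(ℝ, Rn (n + m)) ∞ E] in
theorem DividedChart.comp_inverse_parFst (c : DividedChart n m E) {A : Rn n →L[ℝ] Rn (n + m)}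
    (hu : IsUnit (c.parFst A)) (h0 : c.parSnd A = 0) :
    A.comp (Ring.inverse (c.parFst A)) =
      (c.split.symm : Rn n × Rn m →L[ℝ] Rn (n + m)).comp
        (ContinuousLinearMap.inl ℝ (Rn n) (Rn m)) := by
  ext1 z
  apply c.split.injective
  change c.split (A _) = c.split (c.split.symm (z, 0))
  rw [c.split.apply_symm_apply]
  exact Prod.ext (DFunLike.congr_fun (Ring.mul_inverse_cancel _ hu) z)
    (DFunLike.congr_fun h0 _)

/-- The prolongation covers the projection to `E`, so both velocities in `E` have the same image
under the injective differential of the preferred chart. -/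
theorem christoffel_mfderiv_prolongE
    (Γ : CovariantDerivative 𝓘(ℝ, Rn (n + m)) (Rn (n + m))
      (TangentSpace 𝓘(ℝ, Rn (n + m)) : E → Type))
    {Φ : ParJet n m M E} (h : Φ ∈ immJet n m M E) {θ : JetSub n m E} (hθ : prolongE Φ = θ)
    (ξ : TangentSpace (ParJetModel n m) Φ) :
    christoffel Γ θ.pt (mfderiv 𝓘(ℝ, (Rn n × Rn m) × (Rn n →L[ℝ] Rn m)) 𝓘(ℝ, Rn (n + m))
      (JetSub.pt : JetSub n m E → E) θ (show (Rn n × Rn m) × (Rn n →L[ℝ] Rn m) from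
        mfderiv (ParJetModel n m) 𝓘(ℝ, (Rn n × Rn m) × (Rn n →L[ℝ] Rn m)) prolongE Φ ξ)) =
    christoffel Γ Φ.1.2 (mfderiv (ParJetModel n m) 𝓘(ℝ, Rn (n + m))
      (fun Φ' : ParJet n m M E => Φ'.1.2) Φ ξ) := by
  have hv := congrArg Prod.fst (mfderiv_prolongE h hθ ξ)
  have hpt := diff_mfderiv_pt θ (show (Rn n × Rn m) × (Rn n →L[ℝ] Rn m) from
    mfderiv (ParJetModel n m) 𝓘(ℝ, (Rn n × Rn m) × (Rn n →L[ℝ] Rn m)) prolongE Φ ξ)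
  have hinj := ((preferredChart θ).diff_bijective (mem_preferredChart_domain θ).1).1
  -- The point `θ.pt` becomes definitionally `Φ.1.2` only after this substitution; the facts
  -- depending on the chart are collected before it.
  have hθ' := (prolongE_eq h).symm.trans hθ
  subst hθ'
  exact congrArg (christoffel Γ Φ.1.2) (hinj (hpt.trans hv))

/-- The prolongation intertwines the vertical projections. -/
theorem mfderiv_prolongE_upsilonDotPar
    (Γ : CovariantDerivative 𝓘(ℝ, Rn (n + m)) (Rn (n + m))
      (TangentSpace 𝓘(ℝ, Rn (n + m)) : E → Type))
    (Θ : CovariantDerivative 𝓘(ℝ, Rn n) (Rn n) (TangentSpace 𝓘(ℝ, Rn n) : M → Type))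
    (Ξ : CovariantDerivative 𝓘(ℝ, (Rn n × Rn m) × (Rn n →L[ℝ] Rn m)) (Rn n)
      (Horiz : JetSub n m E → Type))
    {Φ : ParJet n m M E} (h : Φ ∈ immJet n m M E) {θ : JetSub n m E} (hθ : prolongE Φ = θ)
    (ξ : TangentSpace (ParJetModel n m) Φ) :
    (mfderiv (ParJetModel n m) 𝓘(ℝ, (Rn n × Rn m) × (Rn n →L[ℝ] Rn m)) prolongE Φ
      (upsilonDotPar Γ Θ Φ ξ) : (Rn n × Rn m) × (Rn n →L[ℝ] Rn m)) =
    (upsilonDot Γ Ξ θ (show (Rn n × Rn m) × (Rn n →L[ℝ] Rn m) from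
      mfderiv (ParJetModel n m) 𝓘(ℝ, (Rn n × Rn m) × (Rn n →L[ℝ] Rn m)) prolongE Φ ξ) :
        TangentSpace 𝓘(ℝ, (Rn n × Rn m) × (Rn n →L[ℝ] Rn m)) θ) := by
  obtain ⟨hu, h0⟩ := preferredChart_parCoord h hθ
  obtain ⟨X, hX⟩ := mfderiv_fibreCoord_upsilonDotPar Γ Θ Φ ξ
  have hG := christoffel_mfderiv_prolongE Γ h hθ ξ
  have hv := congrArg Prod.snd (mfderiv_prolongE h hθ ξ)
  refine (mfderiv_prolongE h hθ (upsilonDotPar Γ Θ Φ ξ)).trans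
    (Eq.trans ?_ (upsilonDot_coord Γ Ξ θ _).symm)
  -- The base velocity vanishes by verticality, and the Θ term vanishes because the second block of
  -- `Φ` is zero.
  rw [mfderiv_pt_upsilonDotPar, hX, (preferredChart θ).parSnd_hom_connection _ _ h0]
  refine Prod.ext (map_zero _) ?_
  -- By `hv`, the first summand Q̇ P⁻¹ is the slope component of the image of `ξ`; only the Γ terms
  -- remain to be compared.
  refine (ContinuousLinearMap.add_comp _ _ _).trans (congrArg₂ (· + ·) hv.symm ?_)
  refine Eq.trans ?_ (congrArg (fun G : Rn (n + m) →L[ℝ] Rn (n + m) =>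
    (preferredChart θ).parSnd (G.comp _)) hG.symm)
  rw [← (preferredChart θ).comp_inverse_parFst hu h0]
  rfl

end Quotient

end

theorem mainTheorem11 {n m : ℕ}
    {E : Type*} [TopologicalSpace E] [ChartedSpace (Rn (n + m)) E]
    [IsManifold 𝓘(ℝ, Rn (n + m)) ∞ E] [T2Space E] [SecondCountableTopology E]
    {M : Type*} [TopologicalSpace M] [ChartedSpace (Rn n) M]
    [IsManifold 𝓘(ℝ, Rn n) ∞ M] [T2Space M] [SecondCountableTopology M]
    (Γ : CovariantDerivative 𝓘(ℝ, Rn (n + m)) (Rn (n + m))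
      (TangentSpace 𝓘(ℝ, Rn (n + m)) : E → Type))
    [CovariantDerivative.ContMDiffCovariantDerivative Γ ∞] (hΓ : Γ.torsion = 0)
    (Θ : CovariantDerivative 𝓘(ℝ, Rn n) (Rn n) (TangentSpace 𝓘(ℝ, Rn n) : M → Type))
    [CovariantDerivative.ContMDiffCovariantDerivative Θ ∞] (hΘ : Θ.torsion = 0)
    (Ξ : CovariantDerivative 𝓘(ℝ, (Rn n × Rn m) × (Rn n →L[ℝ] Rn m)) (Rn n)
      (Horiz : JetSub n m E → Type))
    [CovariantDerivative.ContMDiffCovariantDerivative Ξ ∞] :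
    ∀ Φ ∈ immJet n m M E,
      ContMDiffAt (ParJetModel n m) 𝓘(ℝ, (Rn n × Rn m) × (Rn n →L[ℝ] Rn m)) ∞ prolongE Φ ∧
      ∀ ξ : TangentSpace (ParJetModel n m) Φ,
        mfderiv (ParJetModel n m) 𝓘(ℝ, (Rn n × Rn m) × (Rn n →L[ℝ] Rn m)) prolongE Φ
            (upsilonDotPar Γ Θ Φ ξ) =
          upsilonDot Γ Ξ (prolongE Φ)
            (mfderiv (ParJetModel n m) 𝓘(ℝ, (Rn n × Rn m) × (Rn n →L[ℝ] Rn m)) prolongE Φ ξ) := by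
  intro Φ h
  -- The auxiliary plane `θ` is specialized to `prolongE Φ`.
  exact ⟨contMDiffAt_prolongE h, mfderiv_prolongE_upsilonDotPar Γ Θ Ξ h rfl⟩
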